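/- **Setting.** Fix integers $n\ge 0$, $N\ge 1$, $0\le d_1\le d$ and write $\|\cdot\|$ for the Euclidean norm. Let $\nu$ be a probability measure on $\mathbb R^n$ concentrated on a bounded set $D$. Let $y_x=f(x;\omega)$ and $\hat y_x=\hat f(x;\hat\omega)$ be two jointly measurable random fields with values in $\mathbb R^d$, where $\omega$, $\hat\omega$ are latent random variables, and let $\mu_x$, $\hat\mu_x$ be the laws of $y_x$, $\hat y_x$. For probability measures $\mu,\hat\mu$ on $\mathbb R^d$ let $\Pi_{\mu,\hat\mu}$ be the set of their couplings and $$W_2(\mu,\hat\mu)=\inf_{\pi\in\Pi_{\mu,\hat\mu}}\mathbb E_{(y,\hat y)\sim\pi}\big[\|y-\hat y\|^2\big]^{1/2},\qquad \hat W_2(\mu,\hat\mu)=\inf_{\pi\in\Pi_{\mu,\hat\mu}}\mathbb E_{(y,\hat y)\sim\pi}\Big[\sum_{i\le d_1}(y_i-\hat y_i)^2+\sum_{i>d_1}\mathbf 1_{y_i\neq\hat y_i}\Big]^{1/2}.$$ Let $(x_j,\omega_j,\hat\omega_j)$, $1\le j\le N$, be independent samples with $x_j\sim\nu$ and $\omega_j,\hat\omega_j$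 distributed as $\omega,\hat\omega$, the three being mutually independent; put $y_j=f(x_j;\omega_j)$ and $\hat y_j=\hat f(x_j;\hat\omega_j)$. For $\delta>0$ let $N(x,\delta)$ be the number of $j$ with $\|x_j-x\|\le\delta$, let $\mu^{\rm e}_{x,\delta}$ and $\hat\mu^{\rm e}_{x,\delta}$ be the empirical measures of those $y_j$, respectively $\hat y_j$, with $\|x_j-x\|\le\delta$, and let $\nu^{\rm e}$ be the empirical measure of $x_1,\dots,x_N$. The squared generalized $W_2$ distance of the two fields and the generalized local squared $W_2$ loss are $$\hat W_2^2(y,\hat y)=\int_D\hat W_2^2(\mu_x,\hat\mu_x)\,\nu(dx),\qquad \hat W_{2,\delta}^{2,\rm e}(y,\hat y)=\int_D\hat W_2^2(\mu^{\rm e}_{x,\delta},\hat\mu^{\rm e}_{x,\delta})\,\nu^{\rm e}(dx).$$ **Assumptions.** There are constants $M_0$ and $L\ge0$ such that, for all $x,\tilde x\in D$: 1. $\|y_x\|^2<M_0$ and $\|\hat y_x\|^2<M_0$ almost surely; 2. $W_2(\mu_x,\mu_{\tilde x})\le L\|x-\tilde x\|$ and $W_2(\hat\mu_x,\hat\mu_{\tilde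 x})\le L\|x-\tilde x\|$; 3. the first $d_1$ components of $y_x$ and $\hat y_x$ are real-valued (continuous) and the last $d-d_1$ components are categorical, with integers as class labels: they lie in $\mathbb Z$ almost surely. For a law $\rho$ on $\mathbb R^d$ put $\sigma_i=\sigma_i(\rho)=\big(\int y_i^6\,\rho(dy)\big)^{1/6}$ and $$h(k,d)=\begin{cases}2k^{-1/4}\log(1+k)^{1/2},& d\le4,\\[2pt] 2\Big(k^{-1/4}+\big(\prod_{i=1}^d\frac{\sigma_i}{\sigma_1}\cdot k\big)^{-1/d}\Big),& d>4.\end{cases}$$ Here $\rho=\rho_x$ may be any one of the following: the law of $y_{\tilde x}$ for $\tilde x\sim\nu$ conditioned on $\|\tilde x-x\|\le\delta$; the law of $y_x$; the law of $y_{\tilde x}$ for $\tilde x\sim\nu$; or one of the same three laws for $\hat y$. If $d>4$, assume $\sigma_1(\rho_x)\ge\dots\ge\sigma_d(\rho_x)>0$ for $\nu$-almost every $x$. **Conclusion.** There is a constant $C>0$ depending only on $d$ such that, in this setting and under these assumptions, $$\mathbb E\Big[\big|\hat W_2^2(y,\hat y)-\hat W_{2,\delta}^{2,\rm e}(y,\hat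 y)\big|\Big]\le\frac{4M_0}{\sqrt N}+8CM_0\,\mathbb E\big[h(N(x,\delta),d)\big]+8\sqrt{M_0}\,L\,\delta,$$ where the expectation on the right is over the samples and over $x\sim\nu^{\rm e}$. -/

import Mathlib

open MeasureTheory

universe u v

noncomputable section

namespace RandomField

/-- `ℝᵏ` with the Euclidean (`ℓ²`) norm. -/
abbrev Vec (k : ℕ) : Type := EuclideanSpace ℝ (Fin k)

/-- The probability measures on `ℝᵈ × ℝᵈ` with marginals `μ` and `μ'`. -/
def couplings {d : ℕ} (μ μ' : Measure (Vec d)) : Set (Measure (Vec d × Vec d)) :=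
  {π | IsProbabilityMeasure π ∧ π.map Prod.fst = μ ∧ π.map Prod.snd = μ'}

/-- `inf_π E_π[c(y, y')] ^ (1/2)`, the infimum being over all couplings `π` of `μ` and `μ'`. -/
def transportDist {d : ℕ} (c : Vec d → Vec d → ℝ) (μ μ' : Measure (Vec d)) : ENNReal :=
  ⨅ π ∈ couplings μ μ', (∫⁻ p, ENNReal.ofReal (c p.1 p.2) ∂π) ^ (1 / 2 : ℝ)

/-- The `W₂` distance. -/
def W2 {d : ℕ} (μ μ' : Measure (Vec d)) : ENNReal :=
  transportDist (fun y y' => ‖y - y'‖ ^ 2) μ μ'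

open Classical in
/-- The squared generalized distance of two mixed vectors: squared differences of the first `d₁`
(continuous) components, plus the number of mismatches among the other (categorical) ones. -/
def mixedSqDist {d : ℕ} (d₁ : ℕ) (y y' : Vec d) : ℝ :=
  ∑ i : Fin d, if (i : ℕ) < d₁ then (y i - y' i) ^ 2 else if y i = y' i then 0 else 1

/-- The generalized `W₂` distance, for mixed vectors with `d₁` continuous components. -/
def genW2 {d : ℕ} (d₁ : ℕ) (μ μ' : Measure (Vec d)) : ENNReal :=
  transportDist (mixedSqDist d₁) μ μ'

section Field

variable {n d : ℕ} {Ω Ω' : Type*} [MeasurableSpace Ω] [MeasurableSpace Ω']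

/-- The law of `y_x = f(x; ω)` for a fixed `x`, where `ω ∼ P`. -/
def lawAt (P : Measure Ω) (f : Vec n → Ω → Vec d) (x : Vec n) : Measure (Vec d) :=
  P.map (f x)

/-- The law of `f(x; ω)` for independent `x ∼ ν` and `ω ∼ P`. -/
def overallLaw (ν : Measure (Vec n)) (P : Measure Ω) (f : Vec n → Ω → Vec d) : Measure (Vec d) :=
  (ν.prod P).map (fun p => f p.1 p.2)

/-- The law of `f(x'; ω)` for independent `x' ∼ ν` and `ω ∼ P`, given `‖x' - x‖ ≤ δ`. -/
def localLaw (ν : Measure (Vec n)) (P : Measure Ω) (f : Vec n → Ω → Vec d) (δ : ℝ)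
    (x : Vec n) : Measure (Vec d) :=
  overallLaw (ProbabilityTheory.cond ν {x' | ‖x' - x‖ ≤ δ}) P f

/-- The average squared generalized `W₂` distance of two random fields,
`∫ genW2(μ_x, μ'_x)² ν(dx)`. -/
def genW2SqField (d₁ : ℕ) (ν : Measure (Vec n)) (P : Measure Ω) (P' : Measure Ω')
    (f : Vec n → Ω → Vec d) (f' : Vec n → Ω' → Vec d) : ENNReal :=
  ∫⁻ x, genW2 d₁ (lawAt P f x) (lawAt P' f' x) ^ 2 ∂ν

end Field

section Empirical

variable {n d N : ℕ}

/-- The uniform probability measure on the points `z j`, `j ∈ T` (with multiplicity). -/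
def empirical {α : Type*} [MeasurableSpace α] (T : Finset (Fin N)) (z : Fin N → α) : Measure α :=
  (T.card : ENNReal)⁻¹ • ∑ j ∈ T, Measure.dirac (z j)

open Classical in
/-- The indices of the sample inputs `xs j` with `‖xs j - x‖ ≤ δ`. -/
def nearby (xs : Fin N → Vec n) (δ : ℝ) (x : Vec n) : Finset (Fin N) :=
  Finset.univ.filter (fun j => ‖xs j - x‖ ≤ δ)

/-- The generalized local squared `W₂` loss of the data `(xs j, ys j, ys' j)`: the integral, against
the empirical measure of the inputs, of the squared generalized `W₂` distance of the empirical
measures of those outputs whose input lies within `δ` of `x`. -/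
def genLocalLoss (d₁ : ℕ) (δ : ℝ) (xs : Fin N → Vec n) (ys ys' : Fin N → Vec d) : ENNReal :=
  ∫⁻ x, genW2 d₁ (empirical (nearby xs δ x) ys) (empirical (nearby xs δ x) ys') ^ 2
    ∂(empirical Finset.univ xs)

end Empirical

/-- `σ_i = (∫ y_i⁶ ρ(dy)) ^ (1/6)`. -/
def sixthScale {d : ℕ} (ρ : Measure (Vec d)) (i : Fin d) : ℝ :=
  (∫ y, (y i) ^ 6 ∂ρ) ^ (1 / 6 : ℝ)

/-- The convergence rate function `h(k, d)` with scales `σ_1, …, σ_d`. -/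
def rate {d : ℕ} (σ : Fin d → ℝ) (k : ℕ) : ℝ :=
  if hd : d ≤ 4 then
    2 * (k : ℝ) ^ (-1 / 4 : ℝ) * Real.log (1 + k) ^ (1 / 2 : ℝ)
  else
    2 * ((k : ℝ) ^ (-1 / 4 : ℝ)
      + ((∏ i, σ i / σ ⟨0, by omega⟩) * (k : ℝ)) ^ (-1 / (d : ℝ)))

end RandomField

end

noncomputable section

namespace RandomField

open ProbabilityTheory ENNReal

/-! The error splits into the fluctuation of the inputs and, for fixed inputs, that of the outputs.
The first is the deviation of an average of `N` independent copies of `genW2 d₁ μ_x μ'_x ^ 2`, which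
lies in `[0, 4 M₀]`; its standard deviation gives `4 M₀ / √N`.

For fixed inputs the outputs are independent but not identically distributed, so the local empirical
measure is compared with the average of the laws at the neighbouring inputs. This average is within
`L δ` of the law at the centre, because averaging couplings gives a coupling
(`transportDist_mixture_le`), and the empirical measure is within `C √M₀` times the rate of it in
mean (`exists_W2_empirical_bound`). Distinct integers differ by at least 1, so `genW2 ≤ W2` on the
laws that occur (`genW2_le_W2`). As `genW2` obeys the triangle inequality and is at most `2 √M₀`
here, passing to squares costs a factor `4 √M₀`; the two fields together give the factors `8`.

The empirical rate comes from a dyadic coupling (`exists_multiscale_matching`): match as much mass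
as possible inside the finest cells, pass the remainder to coarser cells, and pay at each level a
squared diameter times the mass excess one level finer. The excess is controlled by the variance of
cell counts and Cauchy–Schwarz. The level contributions are bounded by a common quantity for `d ≤
4`, which gives the logarithm, and are geometrically dominated by the finest level for `d > 4`.

The scales `σ_i` only enlarge the rate, since `σ_i / σ_1 ≤ 1`; hence the law that they come from is
immaterial. Measurability of `W2` in the samples is avoided by measurable majorants and by
inequalities for lower integrals. -/

theorem exists_gluing {X Y Z : Type*} [MeasurableSpace X] [MeasurableSpace Y] [MeasurableSpace Z]
    [StandardBorelSpace X] [Nonempty X] [StandardBorelSpace Z] [Nonempty Z]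
    (π₁ : Measure (X × Y)) (π₂ : Measure (Y × Z)) [IsProbabilityMeasure π₁]
    [IsProbabilityMeasure π₂] (h : π₁.map Prod.snd = π₂.map Prod.fst) :
    ∃ γ : Measure (Y × X × Z), IsProbabilityMeasure γ ∧
      γ.map (fun p => (p.2.1, p.1)) = π₁ ∧ γ.map (fun p => (p.1, p.2.2)) = π₂ := by
  set π₁' : Measure (Y × X) := π₁.map Prod.swap with hπ₁'
  have : IsProbabilityMeasure π₁' := Measure.isProbabilityMeasure_map (by fun_prop)
  have hfst : π₁'.fst = π₂.fst := by
    rw [Measure.fst, Measure.fst, ← h, hπ₁', Measure.map_map (by fun_prop) (by fun_prop)]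
    rfl
  have e₁ : π₂.fst ⊗ₘ π₁'.condKernel = π₁' := by
    rw [← hfst]; exact Measure.disintegrate _ _
  have e₂ : π₂.fst ⊗ₘ π₂.condKernel = π₂ := Measure.disintegrate _ _
  -- Given the common coordinate, the two outer coordinates are drawn independently from the two
  -- disintegrations.
  refine ⟨π₂.fst ⊗ₘ (π₁'.condKernel ×ₖ π₂.condKernel), inferInstance, ?_, ?_⟩
  · have : (π₂.fst ⊗ₘ (π₁'.condKernel ×ₖ π₂.condKernel)).map (fun p => (p.1, p.2.1)) = π₁' := by
      conv_rhs => rw [← e₁]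
      ext s hs
      rw [Measure.map_apply (by fun_prop) hs, Measure.compProd_apply hs,
        Measure.compProd_apply (hs.preimage (by fun_prop))]
      refine lintegral_congr fun y => ?_
      have : Prod.mk y ⁻¹' ((fun p : Y × X × Z => (p.1, p.2.1)) ⁻¹' s)
          = (Prod.mk y ⁻¹' s) ×ˢ Set.univ := by ext; simp
      rw [this, Kernel.prod_apply_prod, measure_univ, mul_one]
    have h2 := congrArg (Measure.map Prod.swap) this
    have h3 : π₁'.map Prod.swap = π₁ := by
      rw [hπ₁', Measure.map_map (by fun_prop) (by fun_prop)]
      simp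
    rw [Measure.map_map (by fun_prop) (by fun_prop), h3] at h2
    exact h2
  · conv_rhs => rw [← e₂]
    ext s hs
    rw [Measure.map_apply (by fun_prop) hs, Measure.compProd_apply hs,
      Measure.compProd_apply (hs.preimage (by fun_prop))]
    refine lintegral_congr fun y => ?_
    have : Prod.mk y ⁻¹' ((fun p : Y × X × Z => (p.1, p.2.2)) ⁻¹' s)
        = Set.univ ×ˢ (Prod.mk y ⁻¹' s) := by ext; simp
    rw [this, Kernel.prod_apply_prod, measure_univ, one_mul]

/-! ### Symmetry and triangle inequality for transport distances -/

section Transport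

variable {d : ℕ} {c : Vec d → Vec d → ℝ} {μ μ' μ'' : Measure (Vec d)}

theorem transportDist_le {π : Measure (Vec d × Vec d)} (hπ : π ∈ couplings μ μ') :
    transportDist c μ μ' ≤ (∫⁻ p, ENNReal.ofReal (c p.1 p.2) ∂π) ^ (1 / 2 : ℝ) :=
  iInf₂_le π hπ

theorem prod_mem_couplings [IsProbabilityMeasure μ] [IsProbabilityMeasure μ'] :
    μ.prod μ' ∈ couplings μ μ' :=
  ⟨inferInstance, by simp, by simp⟩

theorem transportDist_comm (hc : Measurable fun p : Vec d × Vec d => c p.1 p.2)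
    (hs : ∀ y y', c y y' = c y' y) : transportDist c μ μ' = transportDist c μ' μ := by
  have key : ∀ μ μ' : Measure (Vec d), transportDist c μ μ' ≤ transportDist c μ' μ := by
    intro μ μ'
    refine le_iInf₂ fun π hπ => ?_
    obtain ⟨h0, h1, h2⟩ := hπ
    have hmem : π.map Prod.swap ∈ couplings μ μ' := by
      refine ⟨Measure.isProbabilityMeasure_map (by fun_prop), ?_, ?_⟩
      · rw [Measure.map_map (by fun_prop) (by fun_prop)]; exact h2
      · rw [Measure.map_map (by fun_prop) (by fun_prop)]; exact h1
    refine (transportDist_le hmem).trans_eq ?_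
    rw [lintegral_map (by fun_prop) (by fun_prop)]
    simp only [Prod.fst_swap, Prod.snd_swap, hs]
  exact le_antisymm (key _ _) (key _ _)

theorem transportDist_triangle (hc : Measurable fun p : Vec d × Vec d => c p.1 p.2)
    (ht : ∀ y y' y'', √(c y y'') ≤ √(c y y') + √(c y' y'')) (h0 : ∀ y y', 0 ≤ c y y') :
    transportDist c μ μ'' ≤ transportDist c μ μ' + transportDist c μ' μ'' := by
  have hpt : ∀ y y', ENNReal.ofReal (c y y') = ENNReal.ofReal (√(c y y')) ^ (2 : ℝ) := by
    intro y y'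
    rw [ENNReal.ofReal_rpow_of_nonneg (Real.sqrt_nonneg _) (by norm_num)]
    congr 1
    rw [Real.rpow_two, Real.sq_sqrt (h0 _ _)]
  rw [transportDist, transportDist, transportDist]
  simp only [ENNReal.iInf_add, ENNReal.add_iInf]
  refine le_iInf₂ fun π₂ h₂ => le_iInf₂ fun π₁ h₁ => ?_
  obtain ⟨p₁, a₁, b₁⟩ := h₁
  obtain ⟨p₂, a₂, b₂⟩ := h₂
  obtain ⟨γ, hγ, g₁, g₂⟩ := exists_gluing π₁ π₂ (b₁.trans a₂.symm)
  have hmem : γ.map Prod.snd ∈ couplings μ μ'' := by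
    refine ⟨Measure.isProbabilityMeasure_map (by fun_prop), ?_, ?_⟩
    · rw [← a₁, ← g₁, Measure.map_map (by fun_prop) (by fun_prop),
        Measure.map_map (by fun_prop) (by fun_prop)]; rfl
    · rw [← b₂, ← g₂, Measure.map_map (by fun_prop) (by fun_prop),
        Measure.map_map (by fun_prop) (by fun_prop)]; rfl
  refine (transportDist_le hmem).trans ?_
  rw [← g₁, ← g₂, lintegral_map (by fun_prop) (by fun_prop),
    lintegral_map (by fun_prop) (by fun_prop), lintegral_map (by fun_prop) (by fun_prop)]
  simp only [hpt]
  -- Minkowski's inequality in `L²` of the glued measure, applied to the square roots of the costs.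
  refine le_trans ?_ (ENNReal.lintegral_Lp_add_le (p := 2) (by fun_prop) (by fun_prop) (by norm_num))
  gcongr with p
  simp only [Pi.add_apply]
  rw [← ENNReal.ofReal_add (Real.sqrt_nonneg _) (Real.sqrt_nonneg _)]
  exact ENNReal.ofReal_le_ofReal (ht _ _ _)

end Transport

/-! ### The mixed continuous and categorical distance -/

section Mixed

variable {d : ℕ} (d₁ : ℕ)

theorem measurable_mixedSqDist :
    Measurable fun p : Vec d × Vec d => mixedSqDist d₁ p.1 p.2 := by
  unfold mixedSqDist
  refine Finset.measurable_sum _ fun i _ => ?_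
  split_ifs
  · fun_prop
  · refine Measurable.ite ?_ measurable_const measurable_const
    exact measurableSet_eq_fun (f := fun p : Vec d × Vec d => p.1 i) (g := fun p => p.2 i)
      (by fun_prop) (by fun_prop)

theorem mixedSqDist_nonneg (y y' : Vec d) : 0 ≤ mixedSqDist d₁ y y' :=
  Finset.sum_nonneg fun i _ => by split_ifs <;> positivity

theorem mixedSqDist_comm (y y' : Vec d) : mixedSqDist d₁ y y' = mixedSqDist d₁ y' y := by
  refine Finset.sum_congr rfl fun i _ => ?_
  split_ifs <;> grind

theorem mixedSqDist_top (y y' : Vec d) : mixedSqDist d y y' = ‖y - y'‖ ^ 2 := by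
  simp [mixedSqDist, EuclideanSpace.norm_sq_eq]

/-- With no categorical components the two distances agree, so `W2` inherits the triangle inequality
of `genW2`. -/
theorem genW2_top (μ μ' : Measure (Vec d)) : genW2 d μ μ' = W2 μ μ' := by
  simp only [genW2, W2, transportDist, mixedSqDist_top]

open Classical in
/-- The vector of coordinatewise distances whose Euclidean norm is the mixed distance. -/
def mixedGap (y y' : Vec d) : Vec d :=
  WithLp.toLp 2 fun i => if (i : ℕ) < d₁ then |y i - y' i| else if y i = y' i then 0 else 1

theorem sqrt_mixedSqDist (y y' : Vec d) : √(mixedSqDist d₁ y y') = ‖mixedGap d₁ y y'‖ := by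
  rw [EuclideanSpace.norm_eq]
  congr 1
  refine Finset.sum_congr rfl fun i _ => ?_
  simp only [mixedGap]
  split_ifs <;> simp

/-- Each coordinate gap is a metric, usual or discrete, and the Euclidean norm is monotone in
nonnegative coordinates. -/
theorem sqrt_mixedSqDist_triangle (y y' y'' : Vec d) :
    √(mixedSqDist d₁ y y'') ≤ √(mixedSqDist d₁ y y') + √(mixedSqDist d₁ y' y'') := by
  rw [sqrt_mixedSqDist, sqrt_mixedSqDist, sqrt_mixedSqDist]
  refine le_trans ?_ (norm_add_le _ _)
  rw [EuclideanSpace.norm_eq, EuclideanSpace.norm_eq]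
  refine Real.sqrt_le_sqrt (Finset.sum_le_sum fun i _ => ?_)
  have h0 : 0 ≤ mixedGap d₁ y y'' i := by
    simp only [mixedGap]; split_ifs <;> positivity
  have h1 : mixedGap d₁ y y'' i ≤ (mixedGap d₁ y y' + mixedGap d₁ y' y'') i := by
    simp only [mixedGap, PiLp.add_apply]
    split_ifs <;> first | exact abs_sub_le _ _ _ | grind
  gcongr
  rw [Real.norm_of_nonneg h0, Real.norm_of_nonneg (h0.trans h1)]
  exact h1

theorem genW2_comm (μ μ' : Measure (Vec d)) : genW2 d₁ μ μ' = genW2 d₁ μ' μ :=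
  transportDist_comm (measurable_mixedSqDist d₁) (mixedSqDist_comm d₁)

theorem genW2_triangle (μ μ' μ'' : Measure (Vec d)) :
    genW2 d₁ μ μ'' ≤ genW2 d₁ μ μ' + genW2 d₁ μ' μ'' :=
  transportDist_triangle (measurable_mixedSqDist d₁) (sqrt_mixedSqDist_triangle d₁)
    (mixedSqDist_nonneg d₁)

/-- The vectors whose components after the first `d₁` are integers. -/
def lattice : Set (Vec d) := {y | ∀ i : Fin d, d₁ ≤ (i : ℕ) → ∃ k : ℤ, y i = k}

variable {d₁}

theorem mixedSqDist_le {y y' : Vec d} (hy : y ∈ lattice d₁) (hy' : y' ∈ lattice d₁) :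
    mixedSqDist d₁ y y' ≤ ‖y - y'‖ ^ 2 := by
  rw [EuclideanSpace.norm_sq_eq]
  refine Finset.sum_le_sum fun i _ => ?_
  simp only [PiLp.sub_apply, Real.norm_eq_abs, sq_abs]
  split_ifs with h1 h2
  · exact le_rfl
  · positivity
  · obtain ⟨a, ha⟩ := hy i (not_lt.1 h1)
    obtain ⟨b, hb⟩ := hy' i (not_lt.1 h1)
    rw [ha, hb] at h2 ⊢
    have : a - b ≠ 0 := by
      intro h; exact h2 (by rw [sub_eq_zero.1 h])
    -- Unequal integer labels are at distance at least 1, which pays for the mismatch.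
    have h3 : 1 ≤ (a - b) ^ 2 := by
      have := sq_pos_of_ne_zero this; omega
    exact_mod_cast h3

theorem ae_of_mem_couplings {μ μ' : Measure (Vec d)} {π : Measure (Vec d × Vec d)}
    (hπ : π ∈ couplings μ μ') {p q : Vec d → Prop} (hp : ∀ᵐ y ∂μ, p y) (hq : ∀ᵐ y ∂μ', q y) :
    ∀ᵐ z ∂π, p z.1 ∧ q z.2 := by
  obtain ⟨-, h1, h2⟩ := hπ
  rw [← h1] at hp
  rw [← h2] at hq
  exact (ae_of_ae_map (by fun_prop) hp).and (ae_of_ae_map (by fun_prop) hq)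

theorem genW2_le_W2 {μ μ' : Measure (Vec d)} (hμ : ∀ᵐ y ∂μ, y ∈ lattice d₁)
    (hμ' : ∀ᵐ y ∂μ', y ∈ lattice d₁) : genW2 d₁ μ μ' ≤ W2 μ μ' := by
  refine le_iInf₂ fun π hπ => (transportDist_le hπ).trans ?_
  gcongr ?_ ^ _
  refine lintegral_mono_ae ?_
  filter_upwards [ae_of_mem_couplings hπ hμ hμ'] with z hz
  exact ENNReal.ofReal_le_ofReal (mixedSqDist_le hz.1 hz.2)

theorem W2_le_of_norm_sq_lt {μ μ' : Measure (Vec d)} [IsProbabilityMeasure μ]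
    [IsProbabilityMeasure μ'] {M : ℝ} (hμ : ∀ᵐ y ∂μ, ‖y‖ ^ 2 < M) (hμ' : ∀ᵐ y ∂μ', ‖y‖ ^ 2 < M) :
    W2 μ μ' ≤ ENNReal.ofReal (2 * √M) := by
  refine (transportDist_le prod_mem_couplings).trans ?_
  have hb : ∫⁻ p, ENNReal.ofReal (‖p.1 - p.2‖ ^ 2) ∂(μ.prod μ')
      ≤ ENNReal.ofReal ((2 * √M) ^ 2) := by
    calc _ ≤ ∫⁻ _, ENNReal.ofReal ((2 * √M) ^ 2) ∂(μ.prod μ') := by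
          refine lintegral_mono_ae ?_
          filter_upwards [ae_of_mem_couplings prod_mem_couplings hμ hμ'] with z hz
          refine ENNReal.ofReal_le_ofReal ?_
          have h1 := Real.le_sqrt_of_sq_le hz.1.le
          have h2 := Real.le_sqrt_of_sq_le hz.2.le
          have := norm_sub_le z.1 z.2
          gcongr
          linarith
      _ = _ := by simp
  refine (ENNReal.rpow_le_rpow hb (by norm_num)).trans_eq ?_
  rw [ENNReal.ofReal_rpow_of_nonneg (by positivity) (by norm_num), ← Real.sqrt_eq_rpow,
    Real.sqrt_sq (by positivity)]

end Mixed

/-! ### Multiscale matching along nested partitions -/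

section Matching

variable {X ι : Type*} [MeasurableSpace X] [Countable ι] [MeasurableSpace ι]
  [MeasurableSingletonClass ι]

theorem sum_restrict_fiber {q : X → ι} (hq : Measurable q) (μ : Measure X) :
    Measure.sum (fun i => μ.restrict (q ⁻¹' {i})) = μ := by
  rw [← Measure.restrict_iUnion _ fun i => hq (measurableSet_singleton i)]
  · have : ⋃ i, q ⁻¹' {i} = Set.univ := by ext; simp
    rw [this, Measure.restrict_univ]
  · intro i j hij
    exact Disjoint.preimage _ (by simpa using hij)

theorem measure_univ_eq_tsum_fiber {q : X → ι} (hq : Measurable q) (μ : Measure X) :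
    μ Set.univ = ∑' i, μ (q ⁻¹' {i}) := by
  conv_lhs => rw [← sum_restrict_fiber hq μ]
  rw [Measure.sum_apply _ MeasurableSet.univ]
  simp

/-- If both masses vanish, the inverse is `∞`, but `∞ * 0 = 0` keeps the identity valid; empty cells
need no separate treatment later. -/
theorem inv_max_mul_mul {a b : ℝ≥0∞} (ha : a ≠ ∞) (hb : b ≠ ∞) :
    (max a b)⁻¹ * b * a = min a b := by
  rcases le_total a b with h | h
  · rw [max_eq_right h, min_eq_left h]
    rcases eq_or_ne b 0 with h0 | h0
    · have : a = 0 := le_antisymm (h0 ▸ h) zero_le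
      simp [this]
    · rw [ENNReal.inv_mul_cancel h0 hb, one_mul]
  · rw [max_eq_left h, min_eq_right h]
    rcases eq_or_ne a 0 with h0 | h0
    · have : b = 0 := le_antisymm (h0 ▸ h) zero_le
      simp [this]
    · rw [mul_right_comm, ENNReal.inv_mul_cancel h0 ha, one_mul]

theorem inv_max_mul_le_one (a b : ℝ≥0∞) : (max a b)⁻¹ * b ≤ 1 := by
  calc (max a b)⁻¹ * b ≤ (max a b)⁻¹ * max a b := by gcongr; exact le_max_right _ _
    _ ≤ 1 := ENNReal.inv_mul_le_one _

/-- The part of `μ` that is left when each cell of `q` gives up as much mass as `ν` has there. -/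
def residue (q : X → ι) (μ ν : Measure X) : Measure X :=
  Measure.sum fun i =>
    (1 - (max (μ (q ⁻¹' {i})) (ν (q ⁻¹' {i})))⁻¹ * ν (q ⁻¹' {i})) • μ.restrict (q ⁻¹' {i})

omit [Countable ι] in
theorem residue_fiber {q : X → ι} (hq : Measurable q) (μ ν : Measure X) [IsFiniteMeasure μ]
    [IsFiniteMeasure ν] (i : ι) :
    residue q μ ν (q ⁻¹' {i}) = μ (q ⁻¹' {i}) - ν (q ⁻¹' {i}) := by
  have hm : ∀ i, MeasurableSet (q ⁻¹' {i}) := fun i => hq (measurableSet_singleton i)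
  rw [residue, Measure.sum_apply _ (hm i), tsum_eq_single i]
  · rw [Measure.smul_apply, Measure.restrict_apply (hm i), Set.inter_self, smul_eq_mul,
      ENNReal.sub_mul (fun _ _ => measure_ne_top _ _), one_mul,
      inv_max_mul_mul (measure_ne_top _ _) (measure_ne_top _ _)]
    rcases le_total (μ (q ⁻¹' {i})) (ν (q ⁻¹' {i})) with h | h
    · rw [min_eq_left h, tsub_self, tsub_eq_zero_of_le h]
    · rw [min_eq_right h]
  · intro j hj
    have : q ⁻¹' {i} ∩ q ⁻¹' {j} = ∅ := by
      rw [← Set.preimage_inter]; simp [hj.symm]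
    rw [Measure.smul_apply, Measure.restrict_apply (hm i), this]; simp

/-- The coupling of the common parts of `μ` and `ν` inside the cells of `q`. -/
def cellCoupling (q : X → ι) (μ ν : Measure X) : Measure (X × X) :=
  Measure.sum fun i => (max (μ (q ⁻¹' {i})) (ν (q ⁻¹' {i})))⁻¹ •
    (μ.restrict (q ⁻¹' {i})).prod (ν.restrict (q ⁻¹' {i}))

/-- In a cell with masses `a` and `b`, the normalisation by `max a b` gives the coupling mass `min a
b`, and its first marginal is the fraction `b / max a b` of `μ` there; the residue is the
complementary fraction. -/
theorem cellCoupling_fst_add {q : X → ι} (hq : Measurable q) (μ ν : Measure X)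
    [IsFiniteMeasure μ] [IsFiniteMeasure ν] :
    (cellCoupling q μ ν).map Prod.fst + residue q μ ν = μ := by
  rw [cellCoupling, Measure.map_sum (by fun_prop), residue, Measure.sum_add_sum]
  conv_rhs => rw [← sum_restrict_fiber hq μ]
  congr 1
  funext i
  rw [Measure.map_smul, Measure.map_fst_prod, Measure.restrict_apply_univ, smul_smul, ← add_smul,
    add_tsub_cancel_of_le (inv_max_mul_le_one _ _), one_smul]

theorem cellCoupling_snd_add {q : X → ι} (hq : Measurable q) (μ ν : Measure X)
    [IsFiniteMeasure μ] [IsFiniteMeasure ν] :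
    (cellCoupling q μ ν).map Prod.snd + residue q ν μ = ν := by
  rw [cellCoupling, Measure.map_sum (by fun_prop), residue, Measure.sum_add_sum]
  conv_rhs => rw [← sum_restrict_fiber hq ν]
  congr 1
  funext i
  rw [Measure.map_smul, Measure.map_snd_prod, Measure.restrict_apply_univ, smul_smul, ← add_smul,
    max_comm, add_tsub_cancel_of_le (inv_max_mul_le_one _ _), one_smul]

theorem cellCoupling_ae {q : X → ι} (hq : Measurable q) (μ ν : Measure X)
    [IsFiniteMeasure μ] [IsFiniteMeasure ν] :
    ∀ᵐ p ∂(cellCoupling q μ ν), q p.1 = q p.2 := by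
  rw [cellCoupling, Measure.ae_sum_iff]
  intro i
  refine Measure.ae_smul_measure ?_ _
  have hm : MeasurableSet (q ⁻¹' {i}) := hq (measurableSet_singleton i)
  rw [Measure.prod_restrict]
  filter_upwards [ae_restrict_mem (hm.prod hm)] with p hp
  exact hp.1.trans hp.2.symm

/-- Mass left over at level `l + 1` is exactly the cellwise excess at that level, and only this mass
has to be matched inside the larger cells of level `l`. The induction on `m` matches at the finest
level first and treats the residues recursively. -/
theorem exists_multiscale_matching {q : ℕ → X → ι} (hq : ∀ l, Measurable (q l))
    (hnest : ∀ l x y, q (l + 1) x = q (l + 1) y → q l x = q l y) {c : X × X → ℝ≥0∞}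
    {r : ℕ → ℝ≥0∞} (hc : ∀ l x y, q l x = q l y → c (x, y) ≤ r l) (m : ℕ) (μ ν : Measure X)
    [IsFiniteMeasure μ] [IsFiniteMeasure ν] :
    ∃ (π : Measure (X × X)) (μ' ν' : Measure X),
      π.map Prod.fst + μ' = μ ∧ π.map Prod.snd + ν' = ν ∧
      μ' Set.univ = ∑' i, (μ (q 0 ⁻¹' {i}) - ν (q 0 ⁻¹' {i})) ∧
      ν' Set.univ = ∑' i, (ν (q 0 ⁻¹' {i}) - μ (q 0 ⁻¹' {i})) ∧
      ∫⁻ p, c p ∂π ≤ ∑ l ∈ Finset.range m,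
          r l * ∑' i, (μ (q (l + 1) ⁻¹' {i}) - ν (q (l + 1) ⁻¹' {i})) + r m * μ Set.univ := by
  have hcost : ∀ l (μ ν : Measure X) [IsFiniteMeasure μ] [IsFiniteMeasure ν],
      ∫⁻ p, c p ∂(cellCoupling (q l) μ ν) ≤ r l * μ Set.univ := by
    intro l μ ν _ _
    calc ∫⁻ p, c p ∂(cellCoupling (q l) μ ν)
        ≤ ∫⁻ _, r l ∂(cellCoupling (q l) μ ν) := by
          refine lintegral_mono_ae ?_
          filter_upwards [cellCoupling_ae (hq l) μ ν] with p hp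
          exact hc l _ _ hp
      _ = r l * (cellCoupling (q l) μ ν).map Prod.fst Set.univ := by
          rw [lintegral_const, Measure.map_apply measurable_fst MeasurableSet.univ, Set.preimage_univ]
      _ ≤ r l * μ Set.univ := by
          gcongr
          conv_rhs => rw [← cellCoupling_fst_add (hq l) μ ν]
          exact Measure.le_add_right le_rfl
  induction m generalizing μ ν with
  | zero =>
    refine ⟨cellCoupling (q 0) μ ν, residue (q 0) μ ν, residue (q 0) ν μ,
      cellCoupling_fst_add (hq 0) μ ν, cellCoupling_snd_add (hq 0) μ ν, ?_, ?_, ?_⟩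
    · rw [measure_univ_eq_tsum_fiber (hq 0)]
      exact tsum_congr fun i => residue_fiber (hq 0) μ ν i
    · rw [measure_univ_eq_tsum_fiber (hq 0)]
      exact tsum_congr fun i => residue_fiber (hq 0) ν μ i
    · simpa using hcost 0 μ ν
  | succ m ih =>
    set π₁ := cellCoupling (q (m + 1)) μ ν with hπ₁
    set μ₁ := residue (q (m + 1)) μ ν with hμ₁
    set ν₁ := residue (q (m + 1)) ν μ with hν₁
    have e₁ : π₁.map Prod.fst + μ₁ = μ := cellCoupling_fst_add (hq _) μ ν
    have e₂ : π₁.map Prod.snd + ν₁ = ν := cellCoupling_snd_add (hq _) μ ν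
    have : IsFiniteMeasure μ₁ := isFiniteMeasure_of_le μ (by
      conv_rhs => rw [← e₁]
      exact Measure.le_add_left le_rfl)
    have : IsFiniteMeasure ν₁ := isFiniteMeasure_of_le ν (by
      conv_rhs => rw [← e₂]
      exact Measure.le_add_left le_rfl)
    have : IsFiniteMeasure (π₁.map Prod.snd) := isFiniteMeasure_of_le ν (by
      conv_rhs => rw [← e₂]
      exact Measure.le_add_right le_rfl)
    have hdown : ∀ k l x y, q (l + k) x = q (l + k) y → q l x = q l y := by
      intro k
      induction k with
      | zero => intro l x y h; exact h
      | succ k ihk => intro l x y h; exact ihk l x y (hnest _ _ _ h)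
    -- Matched points share a cell at every coarser level too, so the matching removes equal masses
    -- from both sides and leaves all coarser excesses unchanged.
    have hpres : ∀ l ≤ m + 1, ∀ i, π₁.map Prod.fst (q l ⁻¹' {i}) = π₁.map Prod.snd (q l ⁻¹' {i}) := by
      intro l hl i
      have hm : MeasurableSet (q l ⁻¹' {i}) := hq l (measurableSet_singleton i)
      rw [Measure.map_apply measurable_fst hm, Measure.map_apply measurable_snd hm]
      refine measure_congr ?_
      filter_upwards [cellCoupling_ae (hq (m + 1)) μ ν] with p hp
      obtain ⟨k, hk⟩ := Nat.exists_eq_add_of_le hl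
      have h := hdown k l p.1 p.2 (hk ▸ hp)
      exact propext (by
        change q l p.1 = i ↔ q l p.2 = i
        rw [h])
    have hdiff : ∀ l ≤ m + 1, ∀ i, μ₁ (q l ⁻¹' {i}) - ν₁ (q l ⁻¹' {i})
        = μ (q l ⁻¹' {i}) - ν (q l ⁻¹' {i}) ∧ ν₁ (q l ⁻¹' {i}) - μ₁ (q l ⁻¹' {i})
        = ν (q l ⁻¹' {i}) - μ (q l ⁻¹' {i}) := by
      intro l hl i
      have h1 : μ (q l ⁻¹' {i}) = π₁.map Prod.snd (q l ⁻¹' {i}) + μ₁ (q l ⁻¹' {i}) := by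
        rw [← hpres l hl i, ← Measure.add_apply, e₁]
      have h2 : ν (q l ⁻¹' {i}) = π₁.map Prod.snd (q l ⁻¹' {i}) + ν₁ (q l ⁻¹' {i}) := by
        rw [← Measure.add_apply, e₂]
      rw [h1, h2, ENNReal.add_sub_add_eq_sub_left (measure_ne_top _ _),
        ENNReal.add_sub_add_eq_sub_left (measure_ne_top _ _)]
      exact ⟨rfl, rfl⟩
    obtain ⟨π₂, μ₂, ν₂, f₁, f₂, u₁, u₂, hcost₂⟩ := ih μ₁ ν₁
    refine ⟨π₁ + π₂, μ₂, ν₂, ?_, ?_, ?_, ?_, ?_⟩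
    · rw [Measure.map_add _ _ measurable_fst, add_assoc, f₁, e₁]
    · rw [Measure.map_add _ _ measurable_snd, add_assoc, f₂, e₂]
    · rw [u₁]
      exact tsum_congr fun i => (hdiff 0 (by omega) i).1
    · rw [u₂]
      exact tsum_congr fun i => (hdiff 0 (by omega) i).2
    · rw [lintegral_add_measure, Finset.sum_range_succ, add_comm]
      refine add_le_add (hcost₂.trans ?_) (hcost (m + 1) μ ν)
      refine add_le_add (Finset.sum_le_sum fun l hl => ?_) ?_
      · refine mul_le_mul_right (le_of_eq (tsum_congr fun i => ?_)) _
        exact (hdiff (l + 1) (by have := Finset.mem_range.1 hl; omega) i).1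
      · refine mul_le_mul_right (le_of_eq ?_) _
        -- The terminal term of the induction hypothesis, with the total mass of the residue,
        -- becomes the summand `l = m`.
        rw [measure_univ_eq_tsum_fiber (hq (m + 1)) μ₁]
        exact tsum_congr fun i => residue_fiber (hq _) μ ν i

end Matching

/-! ### Dyadic cells of a cube -/

section Dyadic

variable {d : ℕ}

/-- The index of the cell of side `2 R / 2 ^ l` that contains `y`. -/
def dyadicCell (R : ℝ) (l : ℕ) (y : Vec d) : Fin d → ℤ :=
  fun i => ⌊2 ^ l * ((y i + R) / (2 * R))⌋

theorem measurable_dyadicCell (R : ℝ) (l : ℕ) : Measurable (dyadicCell (d := d) R l) := by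
  unfold dyadicCell
  fun_prop

theorem dyadicCell_nested (R : ℝ) (l : ℕ) (x y : Vec d)
    (h : dyadicCell R (l + 1) x = dyadicCell R (l + 1) y) : dyadicCell R l x = dyadicCell R l y := by
  -- The coarser index is the integer half of the finer one.
  have key : ∀ t : ℝ, ⌊2 ^ l * t⌋ = ⌊2 ^ (l + 1) * t⌋ / 2 := by
    intro t
    have : (2 : ℝ) ^ l * t = (2 ^ (l + 1) * t) / (2 : ℕ) := by
      push_cast; ring
    rw [this, Int.floor_div_natCast]
    rfl
  funext i
  have := congrFun h i
  simp only [dyadicCell] at this ⊢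
  rw [key, key, this]

theorem norm_sub_sq_le_of_dyadicCell_eq {R : ℝ} (hR : 0 < R) (l : ℕ) (x y : Vec d)
    (h : dyadicCell R l x = dyadicCell R l y) : ‖x - y‖ ^ 2 ≤ 4 * d * R ^ 2 * (1 / 4) ^ l := by
  rw [EuclideanSpace.norm_sq_eq]
  have : ∀ i ∈ Finset.univ, ‖(x - y) i‖ ^ 2 ≤ 4 * R ^ 2 * (1 / 4) ^ l := by
    intro i _
    have h1 := Int.abs_sub_lt_one_of_floor_eq_floor (congrFun h i)
    rw [← mul_sub, ← sub_div, add_sub_add_right_eq_sub, abs_mul, abs_div, abs_of_pos (by positivity : (0:ℝ) < 2 ^ l),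
      abs_of_pos (by positivity : 0 < 2 * R)] at h1
    have h2 : |x i - y i| ≤ 2 * R * (1 / 2) ^ l := by
      rw [one_div, inv_pow]
      field_simp at h1 ⊢
      linarith
    have h3 : (1 / 4 : ℝ) ^ l = ((1 / 2) ^ l) ^ 2 := by
      rw [← pow_mul, mul_comm, pow_mul]; norm_num
    rw [h3, Real.norm_eq_abs, PiLp.sub_apply]
    calc |x i - y i| ^ 2 ≤ (2 * R * (1 / 2) ^ l) ^ 2 := by gcongr
      _ = _ := by ring
  refine (Finset.sum_le_sum this).trans_eq ?_
  rw [Finset.sum_const, Finset.card_univ, Fintype.card_fin, nsmul_eq_mul]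
  ring

/-- The indices of the cells of level `l` in the cube `[-R, R) ^ d`. -/
def dyadicIndices (d l : ℕ) : Finset (Fin d → ℤ) :=
  Fintype.piFinset fun _ => Finset.Ico 0 (2 ^ l)

theorem card_dyadicIndices (d l : ℕ) : (dyadicIndices d l).card = 2 ^ (d * l) := by
  rw [dyadicIndices, Fintype.card_piFinset]
  simp only [Int.card_Ico, sub_zero, Finset.prod_const, Finset.card_univ, Fintype.card_fin]
  rw [mul_comm, pow_mul]
  congr 1

/-- The strict norm bound keeps every coordinate away from the upper face of the cube, so the index
`2 ^ l` does not occur. -/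
theorem dyadicCell_mem {M : ℝ} {y : Vec d} (hy : ‖y‖ ^ 2 < M) (l : ℕ) :
    dyadicCell (√M) l y ∈ dyadicIndices d l := by
  rw [dyadicIndices, Fintype.mem_piFinset]
  intro i
  have h1 : |y i| < √M := by
    refine Real.lt_sqrt_of_sq_lt (lt_of_le_of_lt ?_ hy)
    have := PiLp.norm_apply_le y i
    rw [Real.norm_eq_abs] at this
    gcongr
  have hR : 0 < √M := (abs_nonneg _).trans_lt h1
  obtain ⟨h2, h3⟩ := abs_lt.1 h1
  have h4 : 0 ≤ (y i + √M) / (2 * √M) := div_nonneg (by linarith) (by positivity)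
  have h5 : (y i + √M) / (2 * √M) < 1 := by rw [div_lt_one (by positivity)]; linarith
  rw [Finset.mem_Ico, dyadicCell]
  refine ⟨Int.floor_nonneg.2 (by positivity), Int.floor_lt.2 ?_⟩
  push_cast
  have : (0 : ℝ) < 2 ^ l := by positivity
  nlinarith

theorem measure_dyadicCell_eq_zero {M : ℝ} {μ : Measure (Vec d)} (hμ : ∀ᵐ y ∂μ, ‖y‖ ^ 2 < M)
    {l : ℕ} {i : Fin d → ℤ} (hi : i ∉ dyadicIndices d l) : μ (dyadicCell (√M) l ⁻¹' {i}) = 0 := by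
  refine measure_mono_null ?_ hμ
  intro y hy h
  exact hi (hy ▸ dyadicCell_mem h l)

theorem sum_dyadicIndices {M : ℝ} {μ : Measure (Vec d)} (hμ : ∀ᵐ y ∂μ, ‖y‖ ^ 2 < M) (l : ℕ) :
    ∑ i ∈ dyadicIndices d l, μ (dyadicCell (√M) l ⁻¹' {i}) = μ Set.univ := by
  rw [measure_univ_eq_tsum_fiber (measurable_dyadicCell (√M) l) μ]
  exact (tsum_eq_sum fun i hi => measure_dyadicCell_eq_zero hμ hi).symm

theorem W2_le_multiscale {M : ℝ} (hM : 0 < M) {μ ν : Measure (Vec d)} [IsProbabilityMeasure μ]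
    [IsProbabilityMeasure ν] (hμ : ∀ᵐ y ∂μ, ‖y‖ ^ 2 < M) (hν : ∀ᵐ y ∂ν, ‖y‖ ^ 2 < M) (m : ℕ) :
    W2 μ ν ≤ (∑ l ∈ Finset.range m, ENNReal.ofReal (4 * d * M * (1 / 4) ^ l) *
        ∑ i ∈ dyadicIndices d (l + 1), (μ (dyadicCell (√M) (l + 1) ⁻¹' {i})
          - ν (dyadicCell (√M) (l + 1) ⁻¹' {i}))
      + ENNReal.ofReal (4 * d * M * (1 / 4) ^ m)) ^ (1 / 2 : ℝ) := by
  obtain ⟨π, μ', ν', e₁, e₂, u₁, u₂, hcost⟩ := exists_multiscale_matching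
    (measurable_dyadicCell (d := d) (√M)) (dyadicCell_nested (√M))
    (c := fun p => ENNReal.ofReal (‖p.1 - p.2‖ ^ 2))
    (r := fun l => ENNReal.ofReal (4 * d * M * (1 / 4) ^ l))
    (fun l x y h => ENNReal.ofReal_le_ofReal (by
      have := norm_sub_sq_le_of_dyadicCell_eq (Real.sqrt_pos.2 hM) l x y h
      rwa [Real.sq_sqrt hM.le] at this)) m μ ν
  -- At level 0 a single cell holds all the mass of either measure; hence nothing is left unmatched
  -- and `π` is a genuine coupling.
  have hone : ∀ (μ : Measure (Vec d)) [IsProbabilityMeasure μ], (∀ᵐ y ∂μ, ‖y‖ ^ 2 < M) → ∀ i,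
      μ (dyadicCell (√M) 0 ⁻¹' {i}) = if i = 0 then 1 else 0 := by
    intro μ _ hμ i
    have hcard : dyadicIndices d 0 = {0} := by
      ext i
      simp only [dyadicIndices, Fintype.mem_piFinset, Finset.mem_Ico, pow_zero,
        Finset.mem_singleton, funext_iff, Pi.zero_apply]
      exact forall_congr' fun _ => by omega
    split_ifs with h
    · have := sum_dyadicIndices hμ 0
      rw [hcard, Finset.sum_singleton, measure_univ] at this
      rw [h, this]
    · exact measure_dyadicCell_eq_zero hμ (by rw [hcard]; simpa using h)
  have z₁ : μ' = 0 := by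
    rw [← Measure.measure_univ_eq_zero, u₁]
    simp [hone μ hμ, hone ν hν]
  have z₂ : ν' = 0 := by
    rw [← Measure.measure_univ_eq_zero, u₂]
    simp [hone μ hμ, hone ν hν]
  rw [z₁, add_zero] at e₁
  rw [z₂, add_zero] at e₂
  have hmem : π ∈ couplings μ ν := by
    refine ⟨⟨?_⟩, e₁, e₂⟩
    have := measure_univ (μ := μ)
    rwa [← e₁, Measure.map_apply measurable_fst MeasurableSet.univ, Set.preimage_univ] at this
  refine (transportDist_le hmem).trans (ENNReal.rpow_le_rpow (hcost.trans ?_) (by norm_num))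
  rw [measure_univ, mul_one]
  refine add_le_add (Finset.sum_le_sum fun l _ => ?_) le_rfl
  rw [tsum_eq_sum fun i hi => ?_]
  rw [measure_dyadicCell_eq_zero hμ hi, zero_tsub]

end Dyadic

/-! ### Mean deviation of empirical measures -/

section Deviation

variable {Θ : Type*} [MeasurableSpace Θ]

theorem lintegral_rpow_half_le {Q : Measure Θ} [IsProbabilityMeasure Q] {G : Θ → ℝ≥0∞}
    (hG : AEMeasurable G Q) :
    ∫⁻ θ, G θ ^ (1 / 2 : ℝ) ∂Q ≤ (∫⁻ θ, G θ ∂Q) ^ (1 / 2 : ℝ) := by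
  have h := ENNReal.lintegral_mul_le_Lp_mul_Lq Q Real.HolderConjugate.two_two
    (hG.pow_const (1 / 2 : ℝ)) (aemeasurable_const (b := (1 : ℝ≥0∞)))
  have h2 : ∀ a : ℝ≥0∞, (a ^ (1 / 2 : ℝ)) ^ (2 : ℝ) = a := by
    intro a
    rw [← ENNReal.rpow_mul]; simp
  simp only [h2] at h
  simpa using h

theorem lintegral_abs_sub_integral_le {Q : Measure Θ} [IsProbabilityMeasure Q] {X : Θ → ℝ}
    (hX : MemLp X 2 Q) :
    ∫⁻ θ, ENNReal.ofReal |X θ - ∫ θ', X θ' ∂Q| ∂Q ≤ ENNReal.ofReal √(Var[X; Q]) := by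
  have hm : AEMeasurable (fun θ => ‖X θ - ∫ θ', X θ' ∂Q‖ₑ ^ 2) Q :=
    (hX.aemeasurable.sub_const _).enorm.pow_const _
  have h := lintegral_rpow_half_le hm
  have h2 : ∀ a : ℝ≥0∞, (a ^ 2) ^ (1 / 2 : ℝ) = a := by
    intro a
    rw [← ENNReal.rpow_two, ← ENNReal.rpow_mul]; simp
  simp only [h2] at h
  simp only [← Real.enorm_eq_ofReal_abs]
  refine h.trans_eq ?_
  rw [← evariance, ← hX.ofReal_variance_eq,
    ENNReal.ofReal_rpow_of_nonneg (variance_nonneg _ _) (by norm_num), ← Real.sqrt_eq_rpow]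

variable {N d : ℕ}

/-- The average of the measures `μs j`, `j ∈ T`. -/
def mixture {α : Type*} [MeasurableSpace α] (T : Finset (Fin N)) (μs : Fin N → Measure α) :
    Measure α :=
  (T.card : ENNReal)⁻¹ • ∑ j ∈ T, μs j

theorem mixture_apply {α : Type*} [MeasurableSpace α] (T : Finset (Fin N))
    (μs : Fin N → Measure α) (A : Set α) :
    mixture T μs A = (T.card : ENNReal)⁻¹ * ∑ j ∈ T, μs j A := by
  simp [mixture]

theorem empirical_eq_mixture {α : Type*} [MeasurableSpace α] (T : Finset (Fin N))
    (z : Fin N → α) : empirical T z = mixture T fun j => Measure.dirac (z j) := rfl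

theorem isProbabilityMeasure_mixture {α : Type*} [MeasurableSpace α] {T : Finset (Fin N)}
    (hT : T.Nonempty) (μs : Fin N → Measure α) [∀ j, IsProbabilityMeasure (μs j)] :
    IsProbabilityMeasure (mixture T μs) := by
  refine ⟨?_⟩
  rw [mixture_apply]
  simp only [measure_univ, Finset.sum_const, nsmul_eq_mul, mul_one]
  exact ENNReal.inv_mul_cancel (by simpa using hT.ne_empty) (by simp)

theorem isProbabilityMeasure_empirical {α : Type*} [MeasurableSpace α] {T : Finset (Fin N)}
    (hT : T.Nonempty) (z : Fin N → α) : IsProbabilityMeasure (empirical T z) :=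
  isProbabilityMeasure_mixture hT _

theorem ae_mixture {α : Type*} [MeasurableSpace α] {T : Finset (Fin N)}
    {μs : Fin N → Measure α} {p : α → Prop} (h : ∀ j ∈ T, ∀ᵐ y ∂(μs j), p y) :
    ∀ᵐ y ∂(mixture T μs), p y := by
  rw [ae_iff, mixture_apply, Finset.sum_eq_zero, mul_zero]
  exact fun j hj => h j hj

theorem lintegral_mixture {α : Type*} [MeasurableSpace α] (T : Finset (Fin N))
    (μs : Fin N → Measure α) (F : α → ℝ≥0∞) :
    ∫⁻ y, F y ∂(mixture T μs) = (T.card : ENNReal)⁻¹ * ∑ j ∈ T, ∫⁻ y, F y ∂(μs j) := by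
  rw [mixture, lintegral_smul_measure, lintegral_finsetSum_measure, smul_eq_mul]

variable {α : Type*} [MeasurableSpace α]

/-- The empirical mass of `A` is an average of independent indicators, and the variance of an
indicator is at most its mean. Identical distribution is not needed. -/
theorem lintegral_mixture_sub_empirical_le (Q : Measure Θ) [IsProbabilityMeasure Q]
    {T : Finset (Fin N)} (hT : T.Nonempty) {g : Fin N → Θ → α} (hg : ∀ j, Measurable (g j))
    {A : Set α} (hA : MeasurableSet A) :
    ∫⁻ θ, (mixture T (fun j => Q.map (g j)) A - empirical T (fun j => g j (θ j)) A)
        ∂(Measure.pi fun _ : Fin N => Q)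
      ≤ ENNReal.ofReal √((mixture T (fun j => Q.map (g j)) A).toReal / T.card) := by
  set k : ℝ := (T.card : ℝ) with hk
  have hk0 : 0 < k := by rw [hk]; exact_mod_cast hT.card_pos
  set X : Fin N → Θ → ℝ := fun j => (g j ⁻¹' A).indicator 1 with hX
  have hXm : ∀ j, Measurable (X j) := fun j => measurable_one.indicator (hg j hA)
  have hX01 : ∀ j θ, X j θ ∈ Set.Icc (0 : ℝ) 1 := by
    intro j θ
    by_cases h : θ ∈ g j ⁻¹' A <;> simp [hX, h]
  have hX2 : ∀ j, MemLp (X j) 2 Q := fun j =>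
    memLp_of_bounded (Filter.Eventually.of_forall (hX01 j)) (hXm j).aestronglyMeasurable 2
  set P := Measure.pi fun _ : Fin N => Q with hP
  have hmp : ∀ j, MeasurePreserving (fun θ : Fin N → Θ => θ j) P Q := fun j =>
    measurePreserving_eval _ j
  set Y : Fin N → (Fin N → Θ) → ℝ := fun j θ => X j (θ j) with hY
  have hY2 : ∀ j, MemLp (Y j) 2 P := fun j => (hX2 j).comp_measurePreserving (hmp j)
  have hind : iIndepFun Y P := iIndepFun_pi fun j => (hXm j).aemeasurable
  have hEY : ∀ j, ∫ θ, Y j θ ∂P = (Q.map (g j) A).toReal := by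
    intro j
    have h1 : ∫ θ, Y j θ ∂P = ∫ t, X j t ∂(P.map fun θ => θ j) :=
      (integral_map (hmp j).measurable.aemeasurable (hXm j).aestronglyMeasurable).symm
    rw [h1, (hmp j).map_eq, hX, integral_indicator_one (hg j hA), measureReal_def,
      Measure.map_apply (hg j) hA]
  have hVar : ∀ j, Var[Y j; P] ≤ (Q.map (g j) A).toReal := by
    intro j
    refine (variance_le_expectation_sq (hY2 j).aestronglyMeasurable).trans_eq ?_
    rw [← hEY j]
    refine integral_congr_ae (Filter.Eventually.of_forall fun θ => ?_)
    by_cases h : θ j ∈ g j ⁻¹' A <;> simp [hY, hX, h]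
  set S : (Fin N → Θ) → ℝ := ∑ j ∈ T, Y j with hS
  have hS2 : MemLp S 2 P := memLp_finsetSum' _ fun j _ => hY2 j
  have hES : ∫ θ, S θ ∂P = ∑ j ∈ T, (Q.map (g j) A).toReal := by
    simp only [hS, Finset.sum_apply]
    rw [integral_finsetSum _ fun j _ => (hY2 j).integrable (by norm_num)]
    exact Finset.sum_congr rfl fun j _ => hEY j
  have hVS : Var[S; P] ≤ ∑ j ∈ T, (Q.map (g j) A).toReal := by
    rw [hS, IndepFun.variance_sum (fun j _ => hY2 j) fun i _ j _ hij => hind.indepFun hij]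
    exact Finset.sum_le_sum fun j _ => hVar j
  have hpr : ∀ j, IsProbabilityMeasure (Q.map (g j)) := fun j =>
    Measure.isProbabilityMeasure_map (hg j).aemeasurable
  have hmix : mixture T (fun j => Q.map (g j)) A
      = ENNReal.ofReal ((∑ j ∈ T, (Q.map (g j) A).toReal) / k) := by
    rw [mixture_apply, ENNReal.ofReal_div_of_pos hk0, ENNReal.ofReal_sum_of_nonneg
      (fun _ _ => ENNReal.toReal_nonneg), hk, ENNReal.ofReal_natCast, div_eq_mul_inv, mul_comm]
    congr 1
    exact Finset.sum_congr rfl fun j _ => (ENNReal.ofReal_toReal (measure_ne_top _ _)).symm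
  have hemp : ∀ θ : Fin N → Θ, empirical T (fun j => g j (θ j)) A = ENNReal.ofReal (S θ / k) := by
    intro θ
    rw [empirical_eq_mixture, mixture_apply, hS, Finset.sum_apply, ENNReal.ofReal_div_of_pos hk0,
      ENNReal.ofReal_sum_of_nonneg (fun j _ => (hX01 j _).1), hk, ENNReal.ofReal_natCast,
      div_eq_mul_inv, mul_comm]
    congr 1
    refine Finset.sum_congr rfl fun j _ => ?_
    rw [Measure.dirac_apply' _ hA]
    by_cases h : g j (θ j) ∈ A <;> simp [hX, h]
  calc _ ≤ ∫⁻ θ, ENNReal.ofReal k⁻¹ * ENNReal.ofReal |S θ - ∫ θ', S θ' ∂P| ∂P := by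
        refine lintegral_mono fun θ => ?_
        rw [hmix, hemp, ← hES, ← ENNReal.ofReal_sub _ (by
          have : 0 ≤ S θ := by
            rw [hS, Finset.sum_apply]; exact Finset.sum_nonneg fun j _ => (hX01 j _).1
          positivity), ← ENNReal.ofReal_mul (by positivity)]
        refine ENNReal.ofReal_le_ofReal ?_
        rw [← sub_div, div_eq_inv_mul, abs_sub_comm]
        gcongr
        exact le_abs_self _
    _ ≤ ENNReal.ofReal k⁻¹ * ENNReal.ofReal √(∑ j ∈ T, (Q.map (g j) A).toReal) := by
        rw [lintegral_const_mul' _ _ ENNReal.ofReal_ne_top]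
        gcongr
        refine (lintegral_abs_sub_integral_le hS2).trans (ENNReal.ofReal_le_ofReal ?_)
        exact Real.sqrt_le_sqrt hVS
    _ = _ := by
        rw [hmix, ENNReal.toReal_ofReal (by positivity), ← ENNReal.ofReal_mul (by positivity),
          div_div, Real.sqrt_div' _ (by positivity), Real.sqrt_mul_self hk0.le, div_eq_inv_mul]

theorem measurable_empirical_apply (T : Finset (Fin N)) {g : Fin N → Θ → α}
    (hg : ∀ j, Measurable (g j)) {A : Set α} (hA : MeasurableSet A) :
    Measurable fun θ : Fin N → Θ => empirical T (fun j => g j (θ j)) A := by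
  simp only [empirical_eq_mixture, mixture_apply]
  refine (Finset.measurable_sum _ fun j _ => ?_).const_mul _
  simp only [Measure.dirac_apply' _ hA]
  exact (measurable_one.indicator hA).comp ((hg j).comp (measurable_pi_apply j))

/-- Cauchy–Schwarz: the cell deviations add up to at most the root of the number of cells over the
sample size. -/
theorem sum_sqrt_div_le {ι : Type*} (s : Finset ι) {a : ι → ℝ} (ha : ∀ i, 0 ≤ a i)
    (hs : ∑ i ∈ s, a i ≤ 1) {k : ℝ} (hk : 0 < k) :
    ∑ i ∈ s, √(a i / k) ≤ √(s.card / k) := by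
  refine Real.le_sqrt_of_sq_le (sq_sum_le_card_mul_sum_sq.trans ?_)
  have : ∀ i ∈ s, √(a i / k) ^ 2 = a i / k := fun i _ =>
    Real.sq_sqrt (div_nonneg (ha i) hk.le)
  rw [Finset.sum_congr rfl this, ← Finset.sum_div, ← mul_div_assoc]
  gcongr
  exact mul_le_of_le_one_right (by positivity) hs

/-- The root of the multiscale cost is a measurable majorant `H` built from finitely many cell
masses. Jensen's inequality moves the expectation inside the root. -/
theorem exists_measurable_W2_empirical_le (Q : Measure Θ) [IsProbabilityMeasure Q]
    {T : Finset (Fin N)} (hT : T.Nonempty) {g : Fin N → Θ → Vec d} (hg : ∀ j, Measurable (g j))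
    {M : ℝ} (hM : 0 < M) (hgM : ∀ j ∈ T, ∀ᵐ θ ∂Q, ‖g j θ‖ ^ 2 < M) (m : ℕ) :
    ∃ H : (Fin N → Θ) → ℝ≥0∞, Measurable H ∧
      (∀ᵐ θ ∂(Measure.pi fun _ : Fin N => Q),
        W2 (mixture T fun j => Q.map (g j)) (empirical T fun j => g j (θ j)) ≤ H θ) ∧
      ∫⁻ θ, H θ ∂(Measure.pi fun _ : Fin N => Q) ≤ ENNReal.ofReal √(4 * d * M * (∑ l ∈ Finset.range m,
          (1 / 4) ^ l * √(2 ^ (d * (l + 1)) / T.card) + (1 / 4) ^ m)) := by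
  have hpr : ∀ j, IsProbabilityMeasure (Q.map (g j)) := fun j =>
    Measure.isProbabilityMeasure_map (hg j).aemeasurable
  have hmixp : IsProbabilityMeasure (mixture T fun j => Q.map (g j)) :=
    isProbabilityMeasure_mixture hT _
  have hmixM : ∀ᵐ y ∂(mixture T fun j => Q.map (g j)), ‖y‖ ^ 2 < M := ae_mixture fun j hj =>
    (ae_map_iff (hg j).aemeasurable (measurableSet_lt (by fun_prop) measurable_const)).2 (hgM j hj)
  have hempM : ∀ᵐ θ ∂(Measure.pi fun _ : Fin N => Q),
      ∀ᵐ y ∂(empirical T fun j => g j (θ j)), ‖y‖ ^ 2 < M := by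
    have : ∀ᵐ θ ∂(Measure.pi fun _ : Fin N => Q), ∀ j ∈ T, ‖g j (θ j)‖ ^ 2 < M := by
      rw [ae_all_iff]
      intro j
      by_cases hj : j ∈ T
      · filter_upwards [(measurePreserving_eval (fun _ : Fin N => Q) j).quasiMeasurePreserving.ae
          (hgM j hj)] with θ hθ _ using hθ
      · exact Filter.Eventually.of_forall fun _ h => absurd h hj
    filter_upwards [this] with θ hθ
    exact ae_mixture fun j hj => (ae_dirac_iff (measurableSet_lt (by fun_prop)
      measurable_const)).2 (hθ j hj)
  have hcell : ∀ l (i : Fin d → ℤ), MeasurableSet (dyadicCell (√M) l ⁻¹' {i}) := fun l i =>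
    measurable_dyadicCell _ _ (measurableSet_singleton i)
  set k : ℝ := (T.card : ℝ) with hk
  have hk0 : 0 < k := by rw [hk]; exact_mod_cast hT.card_pos
  have hm : ∀ l i, Measurable fun θ : Fin N → Θ =>
      mixture T (fun j => Q.map (g j)) (dyadicCell (√M) (l + 1) ⁻¹' {i})
      - empirical T (fun j => g j (θ j)) (dyadicCell (√M) (l + 1) ⁻¹' {i}) := fun l i =>
    measurable_const.sub (measurable_empirical_apply T hg (hcell _ i))
  have hm2 : ∀ l, Measurable fun θ : Fin N → Θ =>
      ENNReal.ofReal (4 * d * M * (1 / 4) ^ l) * ∑ i ∈ dyadicIndices d (l + 1),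
      (mixture T (fun j => Q.map (g j)) (dyadicCell (√M) (l + 1) ⁻¹' {i})
      - empirical T (fun j => g j (θ j)) (dyadicCell (√M) (l + 1) ⁻¹' {i})) := fun l =>
    (Finset.measurable_sum _ fun i _ => hm l i).const_mul _
  have hH := (Finset.measurable_sum (Finset.range m) fun l _ => hm2 l).add_const
    (ENNReal.ofReal (4 * d * M * (1 / 4) ^ m))
  refine ⟨fun θ => (∑ l ∈ Finset.range m, ENNReal.ofReal (4 * d * M * (1 / 4) ^ l) *
        ∑ i ∈ dyadicIndices d (l + 1),
          (mixture T (fun j => Q.map (g j)) (dyadicCell (√M) (l + 1) ⁻¹' {i})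
            - empirical T (fun j => g j (θ j)) (dyadicCell (√M) (l + 1) ⁻¹' {i}))
        + ENNReal.ofReal (4 * d * M * (1 / 4) ^ m)) ^ (1 / 2 : ℝ), hH.pow_const _, ?_, ?_⟩
  · filter_upwards [hempM] with θ hθ
    have := isProbabilityMeasure_empirical hT fun j => g j (θ j)
    exact W2_le_multiscale hM hmixM hθ m
  calc _ ≤ (∑ l ∈ Finset.range m, ENNReal.ofReal (4 * d * M * (1 / 4) ^ l) *
        ∑ i ∈ dyadicIndices d (l + 1), ENNReal.ofReal
          √((mixture T (fun j => Q.map (g j)) (dyadicCell (√M) (l + 1) ⁻¹' {i})).toReal / k)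
        + ENNReal.ofReal (4 * d * M * (1 / 4) ^ m)) ^ (1 / 2 : ℝ) := by
        refine (lintegral_rpow_half_le ?_).trans ?_
        · exact hH.aemeasurable
        · refine ENNReal.rpow_le_rpow ?_ (by norm_num)
          rw [lintegral_add_right _ measurable_const, lintegral_const, measure_univ, mul_one,
            lintegral_finsetSum _ fun l _ => hm2 l]
          refine add_le_add (Finset.sum_le_sum fun l _ => ?_) le_rfl
          rw [lintegral_const_mul' _ _ ENNReal.ofReal_ne_top, lintegral_finsetSum _ fun i _ => hm l i]
          gcongr with i hi
          exact lintegral_mixture_sub_empirical_le Q hT hg (hcell _ i)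
    _ ≤ (ENNReal.ofReal (4 * d * M * (∑ l ∈ Finset.range m,
          (1 / 4) ^ l * √(2 ^ (d * (l + 1)) / k) + (1 / 4) ^ m))) ^ (1 / 2 : ℝ) := by
        refine ENNReal.rpow_le_rpow ?_ (by norm_num)
        rw [mul_add, ENNReal.ofReal_add (by positivity) (by positivity), Finset.mul_sum,
          ENNReal.ofReal_sum_of_nonneg (fun l _ => by positivity)]
        refine add_le_add (Finset.sum_le_sum fun l _ => ?_) le_rfl
        rw [← mul_assoc, ENNReal.ofReal_mul (p := 4 * d * M * (1 / 4) ^ l) (by positivity)]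
        refine mul_le_mul' le_rfl ?_
        rw [← ENNReal.ofReal_sum_of_nonneg (fun i _ => Real.sqrt_nonneg _)]
        refine ENNReal.ofReal_le_ofReal ?_
        have hsum : ∑ i ∈ dyadicIndices d (l + 1), (mixture T (fun j => Q.map (g j))
            (dyadicCell (√M) (l + 1) ⁻¹' {i})).toReal ≤ 1 := by
          rw [← ENNReal.toReal_sum fun i _ => measure_ne_top _ _, sum_dyadicIndices hmixM,
            measure_univ, ENNReal.toReal_one]
        have := sum_sqrt_div_le (dyadicIndices d (l + 1)) (a := fun i => (mixture T
          (fun j => Q.map (g j)) (dyadicCell (√M) (l + 1) ⁻¹' {i})).toReal)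
          (fun _ => ENNReal.toReal_nonneg) hsum hk0
        rw [card_dyadicIndices] at this
        exact_mod_cast this
    _ = _ := by
        rw [ENNReal.ofReal_rpow_of_nonneg (by positivity) (by norm_num), ← Real.sqrt_eq_rpow]

end Deviation

/-! ### Optimising the number of levels -/

section Rates

/-- The convergence rate of empirical measures, without the scales. -/
def isotropicRate (d k : ℕ) : ℝ :=
  if d ≤ 4 then 2 * (k : ℝ) ^ (-1 / 4 : ℝ) * Real.log (1 + k) ^ (1 / 2 : ℝ)
  else 2 * (k : ℝ) ^ (-1 / (d : ℝ))

theorem isotropicRate_nonneg (d k : ℕ) : 0 ≤ isotropicRate d k := by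
  have : 0 ≤ Real.log (1 + k) := Real.log_nonneg (by simp)
  unfold isotropicRate
  split_ifs <;> positivity

/-- For `d > 4` the product of scale ratios is at most 1 and the exponent is negative, so the scales
can only increase the rate. -/
theorem isotropicRate_le_rate {d : ℕ} {σ : Fin d → ℝ} {k : ℕ} (hk : 1 ≤ k)
    (hσ : 4 < d → Antitone σ ∧ ∀ i, 0 < σ i) : isotropicRate d k ≤ rate σ k := by
  unfold isotropicRate rate
  split_ifs with hd
  · exact le_rfl
  · obtain ⟨ha, hp⟩ := hσ (not_le.1 hd)
    have hk0 : (0 : ℝ) < k := by exact_mod_cast hk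
    set i₀ : Fin d := ⟨0, by omega⟩
    have h1 : ∏ i, σ i / σ i₀ ≤ 1 := Finset.prod_le_one
      (fun i _ => (div_pos (hp _) (hp _)).le)
      (fun i _ => (div_le_one (hp _)).2 (ha (Fin.mk_le_of_le_val (Nat.zero_le _))))
    have h0 : 0 < ∏ i, σ i / σ i₀ := Finset.prod_pos fun i _ => div_pos (hp _) (hp _)
    have h2 : (k : ℝ) ^ (-1 / (d : ℝ)) ≤ ((∏ i, σ i / σ i₀) * (k : ℝ)) ^ (-1 / (d : ℝ)) := by
      refine Real.rpow_le_rpow_of_nonpos (by positivity) (mul_le_of_le_one_left hk0.le h1) ?_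
      exact div_nonpos_of_nonpos_of_nonneg (by norm_num) (by positivity)
    have h3 : 0 ≤ (k : ℝ) ^ (-1 / 4 : ℝ) := by positivity
    linarith

/-- Every level contributes at most `4 / √k`, because `2 ^ (d / 2) ≤ 4`; about `log k` levels
suffice. -/
theorem multiscale_sum_le_of_le_four {d k : ℕ} (hd : d ≤ 4) (hk : 1 ≤ k) :
    ∃ m : ℕ, 4 * (d : ℝ) * (∑ l ∈ Finset.range m, (1 / 4) ^ l * √(2 ^ (d * (l + 1)) / k)
      + (1 / 4) ^ m) ≤ (10 * isotropicRate d k) ^ 2 := by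
  have hk0 : (0 : ℝ) < k := by exact_mod_cast hk
  have hk1 : (1 : ℝ) ≤ k := by exact_mod_cast hk
  set r := √(k : ℝ) with hr
  have hr0 : 0 < r := Real.sqrt_pos.2 hk0
  set Λ := Real.log (1 + k) with hΛ
  -- This absorbs the remainder `1 / r`, which carries no logarithm.
  have hΛ1 : 1 ≤ 2 * Λ := by
    have h1 := Real.log_two_gt_d9
    have h2 : Real.log 2 ≤ Λ := Real.log_le_log (by norm_num) (by linarith)
    linarith
  have hrate : (10 * isotropicRate d k) ^ 2 = 400 * (Λ / r) := by
    rw [isotropicRate, if_pos hd, mul_pow, mul_pow, mul_pow, ← Real.rpow_natCast (_ ^ _),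
      ← Real.rpow_natCast (_ ^ _), ← Real.rpow_mul hk0.le, ← Real.rpow_mul (by linarith), hr,
      Real.sqrt_eq_rpow, div_eq_mul_inv Λ, ← Real.rpow_neg hk0.le]
    norm_num
    ring
  set m := Nat.log 2 k + 1 with hm
  have hlt : k < 2 ^ m := Nat.lt_pow_succ_log_self (by norm_num) k
  have hle : 2 ^ m ≤ 2 * k := by
    rw [hm, pow_succ, mul_comm]
    exact Nat.mul_le_mul_left 2 (Nat.pow_log_le_self 2 (by omega))
  have hmΛ : (m : ℝ) ≤ 4 * Λ := by
    have h1 : (2 : ℝ) ^ m ≤ (1 + k) ^ 2 := by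
      have : (2 : ℝ) ^ m ≤ 2 * k := by exact_mod_cast hle
      nlinarith
    have h2 := Real.log_le_log (by positivity) h1
    rw [Real.log_pow, Real.log_pow] at h2
    have h3 := Real.log_two_gt_d9
    have h4 : (0 : ℝ) ≤ m := by positivity
    push_cast at h2
    nlinarith
  have hm4 : (1 / 4 : ℝ) ^ m ≤ 1 / r := by
    rw [one_div, inv_pow, one_div]
    refine inv_anti₀ hr0 (Real.sqrt_le_iff.2 ⟨by positivity, ?_⟩)
    have h1 : (k : ℝ) ≤ 2 ^ m := by exact_mod_cast hlt.le
    refine h1.trans ?_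
    rw [← pow_mul, mul_comm, pow_mul]
    exact pow_le_pow_left₀ (by norm_num) (by norm_num) _
  have hterm : ∀ l ∈ Finset.range m, (1 / 4 : ℝ) ^ l * √(2 ^ (d * (l + 1)) / k) ≤ 4 / r := by
    intro l _
    have h1 : √((2 : ℝ) ^ (d * (l + 1)) / k) ≤ 4 ^ (l + 1) / r := by
      rw [Real.sqrt_div (by positivity)]
      gcongr
      refine Real.sqrt_le_iff.2 ⟨by positivity, ?_⟩
      calc (2 : ℝ) ^ (d * (l + 1)) ≤ 2 ^ (4 * (l + 1)) := by gcongr; norm_num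
        _ = (4 ^ (l + 1)) ^ 2 := by
          rw [← pow_mul, mul_comm (l + 1) 2, pow_mul, pow_mul]; norm_num
    calc (1 / 4 : ℝ) ^ l * √(2 ^ (d * (l + 1)) / k) ≤ (1 / 4) ^ l * (4 ^ (l + 1) / r) := by gcongr
      _ = 4 / r := by
        rw [one_div, inv_pow, pow_succ]; field_simp
  refine ⟨m, ?_⟩
  rw [hrate]
  have hd4 : (d : ℝ) ≤ 4 := by exact_mod_cast hd
  calc _ ≤ 4 * 4 * ((m : ℝ) * (4 / r) + 1 / r) := by
        gcongr
        simpa using Finset.sum_le_card_nsmul _ _ _ hterm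
    _ ≤ 4 * 4 * ((4 * Λ) * (4 / r) + (2 * Λ) / r) := by gcongr
    _ = 288 * (Λ / r) := by ring
    _ ≤ 400 * (Λ / r) := by
        have : 0 ≤ Λ / r := div_nonneg (by linarith) hr0.le
        linarith

/-- With `2 ^ (d m) ≤ k < 2 ^ (d (m + 1))` the finest cells have relative side of order `k ^ (-1 /
d)`, and coarser levels decay geometrically relative to the finest one. -/
theorem multiscale_sum_le_of_four_lt {d k : ℕ} (hd : 4 < d) (hk : 1 ≤ k) :
    ∃ m : ℕ, 4 * (d : ℝ) * (∑ l ∈ Finset.range m, (1 / 4) ^ l * √(2 ^ (d * (l + 1)) / k)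
      + (1 / 4) ^ m) ≤ (√(68 * d) * isotropicRate d k) ^ 2 := by
  have hk0 : (0 : ℝ) < k := by exact_mod_cast hk
  have hd0 : (0 : ℝ) < d := by exact_mod_cast (by omega : 0 < d)
  set m := Nat.log (2 ^ d) k with hm
  have hb : 1 < 2 ^ d := Nat.one_lt_two_pow (by omega)
  have hlt : (k : ℝ) < ((2 : ℝ) ^ (m + 1)) ^ d := by
    rw [← pow_mul, mul_comm, pow_mul]
    exact_mod_cast Nat.lt_pow_succ_log_self hb k
  have hle : (2 : ℝ) ^ (d * m) ≤ k := by
    rw [pow_mul]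
    exact_mod_cast Nat.pow_log_le_self (2 ^ d) (by omega : k ≠ 0)
  set w := (k : ℝ) ^ (-1 / (d : ℝ)) with hw
  have hmw : (1 / 2 : ℝ) ^ (m + 1) ≤ w := by
    have h1 : (k : ℝ) ^ (1 / (d : ℝ)) ≤ 2 ^ (m + 1) := by
      have h2 := Real.rpow_le_rpow hk0.le hlt.le (by positivity : 0 ≤ 1 / (d : ℝ))
      rwa [one_div (d : ℝ), Real.pow_rpow_inv_natCast (by positivity) (by omega), ← one_div] at h2
    rw [hw, neg_div, Real.rpow_neg hk0.le, one_div (2 : ℝ), inv_pow]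
    exact inv_anti₀ (by positivity) h1
  have hterm : ∀ l ∈ Finset.range m, (1 / 4 : ℝ) ^ l * √(2 ^ (d * (l + 1)) / k)
      ≤ 4 * (1 / 4) ^ m * (3 / 4) ^ (m - 1 - l) := by
    intro l hl
    obtain ⟨j, hj⟩ := Nat.exists_eq_add_of_lt (Finset.mem_range.1 hl)
    have hj' : m - 1 - l = j := by omega
    rw [hj', hj]
    -- As `d ≥ 5` and `1 / 32 ≤ (3 / 16) ^ 2`, the loss per level is at most `3 / 16`; against the
    -- factor 4 gained in squared diameter this leaves the ratio `3 / 4 < 1`.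
    have h1 : √((2 : ℝ) ^ (d * (l + 1)) / k) ≤ (3 / 16) ^ j := by
      refine Real.sqrt_le_iff.2 ⟨by positivity, ?_⟩
      calc (2 : ℝ) ^ (d * (l + 1)) / k ≤ 2 ^ (d * (l + 1)) / 2 ^ (d * m) := by gcongr
        _ = ((1 / 2) ^ d) ^ j := by
            rw [hj, show d * (l + j + 1) = d * (l + 1) + d * j by ring, pow_add, pow_mul _ d j,
              one_div, inv_pow, inv_pow]
            field_simp
        _ ≤ ((1 / 2) ^ 5) ^ j := by
            gcongr ?_ ^ _
            exact pow_le_pow_of_le_one (by norm_num) (by norm_num) hd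
        _ ≤ ((3 / 16) ^ 2) ^ j := by
            gcongr ?_ ^ _
            norm_num
        _ = ((3 / 16) ^ j) ^ 2 := by rw [← pow_mul, ← pow_mul, mul_comm]
    calc (1 / 4 : ℝ) ^ l * √(2 ^ (d * (l + 1)) / k) ≤ (1 / 4) ^ l * (3 / 16) ^ j := by gcongr
      _ = 4 * (1 / 4) ^ (l + j + 1) * (3 / 4) ^ j := by
          rw [show (3 / 16 : ℝ) = 1 / 4 * (3 / 4) by norm_num, mul_pow, pow_succ, pow_add]
          ring
  have hgeom : ∑ l ∈ Finset.range m, (3 / 4 : ℝ) ^ (m - 1 - l) ≤ 4 := by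
    rw [Finset.sum_range_reflect (fun j => (3 / 4 : ℝ) ^ j) m, geom_sum_eq (by norm_num)]
    have : (0 : ℝ) ≤ (3 / 4) ^ m := by positivity
    rw [div_le_iff_of_neg (by norm_num)]
    linarith
  refine ⟨m, ?_⟩
  rw [isotropicRate, if_neg (not_le.2 hd), mul_pow, Real.sq_sqrt (by positivity), ← hw]
  have hsum := Finset.sum_le_sum hterm
  rw [← Finset.mul_sum] at hsum
  have h4 : (1 / 4 : ℝ) ^ m = 4 * ((1 / 2) ^ (m + 1)) ^ 2 := by
    rw [← pow_mul, mul_comm (m + 1), pow_mul, pow_succ]; norm_num; ring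
  calc _ ≤ 4 * (d : ℝ) * (4 * (1 / 4) ^ m * 4 + (1 / 4) ^ m) := by
        gcongr
        exact hsum.trans (by gcongr)
    _ = 272 * d * ((1 / 2) ^ (m + 1)) ^ 2 := by rw [h4]; ring
    _ ≤ 272 * d * w ^ 2 := by gcongr
    _ = _ := by ring

theorem exists_multiscale_rate (d : ℕ) : ∃ C : ℝ, 0 < C ∧ ∀ k : ℕ, 1 ≤ k → ∃ m : ℕ,
    4 * (d : ℝ) * (∑ l ∈ Finset.range m, (1 / 4) ^ l * √(2 ^ (d * (l + 1)) / k) + (1 / 4) ^ m)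
      ≤ (C * isotropicRate d k) ^ 2 := by
  by_cases hd : d ≤ 4
  · exact ⟨10, by norm_num, fun k hk => multiscale_sum_le_of_le_four hd hk⟩
  · have : (0 : ℝ) < d := by exact_mod_cast (by omega : 0 < d)
    exact ⟨√(68 * d), by positivity, fun k hk => multiscale_sum_le_of_four_lt (not_le.1 hd) hk⟩

/-- The expected `W₂` distance of the empirical measure of independent bounded random vectors from
their average law. -/
theorem exists_W2_empirical_bound.{w} (d : ℕ) : ∃ C : ℝ, 0 < C ∧
    ∀ (N : ℕ) (Θ : Type w) [MeasurableSpace Θ] (Q : Measure Θ) [IsProbabilityMeasure Q]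
      (T : Finset (Fin N)) (_ : T.Nonempty) (g : Fin N → Θ → Vec d) (_ : ∀ j, Measurable (g j))
      (M : ℝ) (_ : 0 < M) (_ : ∀ j ∈ T, ∀ᵐ θ ∂Q, ‖g j θ‖ ^ 2 < M),
      ∃ H : (Fin N → Θ) → ℝ≥0∞, Measurable H ∧
        (∀ᵐ θ ∂(Measure.pi fun _ : Fin N => Q),
          W2 (mixture T fun j => Q.map (g j)) (empirical T fun j => g j (θ j)) ≤ H θ) ∧
        ∫⁻ θ, H θ ∂(Measure.pi fun _ : Fin N => Q)
          ≤ ENNReal.ofReal (C * √M * isotropicRate d T.card) := by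
  obtain ⟨C, hC, h⟩ := exists_multiscale_rate d
  refine ⟨C, hC, fun N Θ _ Q _ T hT g hg M hM hgM => ?_⟩
  obtain ⟨m, hm⟩ := h T.card hT.card_pos
  obtain ⟨H, hH, hae, hint⟩ := exists_measurable_W2_empirical_le Q hT hg hM hgM m
  refine ⟨H, hH, hae, hint.trans (ENNReal.ofReal_le_ofReal ?_)⟩
  have := isotropicRate_nonneg d T.card
  refine Real.sqrt_le_iff.2 ⟨by positivity, ?_⟩
  calc _ = M * (4 * (d : ℝ) * (∑ l ∈ Finset.range m,
        (1 / 4) ^ l * √(2 ^ (d * (l + 1)) / T.card) + (1 / 4) ^ m)) := by ring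
    _ ≤ M * (C * isotropicRate d T.card) ^ 2 := by gcongr
    _ = (C * √M * isotropicRate d T.card) ^ 2 := by
        rw [mul_right_comm, mul_pow _ (√M), Real.sq_sqrt hM.le, mul_comm]

end Rates

/-! ### Averages of laws as intermediate measures -/

section Mixtures

variable {d N : ℕ}

theorem transportDist_mixture_le {c : Vec d → Vec d → ℝ} {μ : Measure (Vec d)}
    {T : Finset (Fin N)} (hT : T.Nonempty) {μs : Fin N → Measure (Vec d)} {B : ℝ≥0∞} (hB : B ≠ ∞)
    (h : ∀ j ∈ T, transportDist c μ (μs j) ≤ B) : transportDist c μ (mixture T μs) ≤ B := by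
  -- The slack `ε` permits near-optimal couplings, so no minimiser has to exist; their average is
  -- then a coupling whose squared cost is the average.
  refine ENNReal.le_of_forall_pos_le_add fun ε hε _ => ?_
  have hlt : ∀ j ∈ T, ∃ π ∈ couplings μ (μs j),
      (∫⁻ p, ENNReal.ofReal (c p.1 p.2) ∂π) ^ (1 / 2 : ℝ) < B + ε := by
    intro j hj
    have : transportDist c μ (μs j) < B + ε :=
      (h j hj).trans_lt (ENNReal.lt_add_right hB (by simpa using hε.ne'))
    simpa only [transportDist, iInf_lt_iff, exists_prop] using this
  choose! π hπ hcost using hlt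
  have hk : (T.card : ℝ≥0∞)⁻¹ * T.card = 1 :=
    ENNReal.inv_mul_cancel (by simpa using hT.ne_empty) (by simp)
  have hprob : IsProbabilityMeasure (mixture T π) := by
    refine ⟨?_⟩
    rw [mixture_apply, Finset.sum_congr rfl fun j hj => (hπ j hj).1.measure_univ]
    simpa using hk
  have hmem : mixture T π ∈ couplings μ (mixture T μs) := by
    refine ⟨hprob, ?_, ?_⟩
    · ext A hA
      rw [Measure.map_apply measurable_fst hA, mixture_apply]
      have : ∀ j ∈ T, π j (Prod.fst ⁻¹' A) = μ A := fun j hj => by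
        rw [← Measure.map_apply measurable_fst hA, (hπ j hj).2.1]
      rw [Finset.sum_congr rfl this, Finset.sum_const, nsmul_eq_mul, ← mul_assoc, hk, one_mul]
    · ext A hA
      rw [Measure.map_apply measurable_snd hA, mixture_apply, mixture_apply]
      congr 1
      refine Finset.sum_congr rfl fun j hj => ?_
      rw [← Measure.map_apply measurable_snd hA, (hπ j hj).2.2]
  have hsq : ∀ a : ℝ≥0∞, (a ^ (2 : ℝ)) ^ (1 / 2 : ℝ) = a := by
    intro a; rw [← ENNReal.rpow_mul]; simp
  have hsq' : ∀ a : ℝ≥0∞, (a ^ (1 / 2 : ℝ)) ^ (2 : ℝ) = a := by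
    intro a; rw [← ENNReal.rpow_mul]; simp
  refine (transportDist_le hmem).trans ?_
  rw [← hsq (B + ε), lintegral_mixture]
  refine ENNReal.rpow_le_rpow ?_ (by norm_num)
  calc (T.card : ℝ≥0∞)⁻¹ * ∑ j ∈ T, ∫⁻ p, ENNReal.ofReal (c p.1 p.2) ∂(π j)
      ≤ (T.card : ℝ≥0∞)⁻¹ * ∑ j ∈ T, (B + ε) ^ (2 : ℝ) := by
        gcongr with j hj
        rw [← hsq' (∫⁻ p, _ ∂(π j))]
        exact ENNReal.rpow_le_rpow (hcost j hj).le (by norm_num)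
    _ = (B + ε) ^ (2 : ℝ) := by
        rw [Finset.sum_const, nsmul_eq_mul, ← mul_assoc, hk, one_mul]

theorem W2_triangle (μ μ' μ'' : Measure (Vec d)) : W2 μ μ'' ≤ W2 μ μ' + W2 μ' μ'' := by
  simpa only [genW2_top] using genW2_triangle d μ μ' μ''

theorem measurableSet_lattice (d₁ : ℕ) : MeasurableSet (lattice d₁ : Set (Vec d)) := by
  have : (lattice d₁ : Set (Vec d))
      = ⋂ i : Fin d, ⋂ _ : d₁ ≤ (i : ℕ), (fun y : Vec d => y i) ⁻¹' Set.range ((↑) : ℤ → ℝ) := by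
    ext y
    simp [lattice, eq_comm]
  rw [this]
  refine MeasurableSet.iInter fun i => MeasurableSet.iInter fun _ => ?_
  exact (Set.countable_range _).measurableSet.preimage (by fun_prop)

/-- The expected generalized `W₂` distance of the empirical measure of independent random vectors
from a law `μ`, in terms of the `W₂` distances of `μ` from the laws of these vectors. -/
theorem exists_genW2_empirical_bound.{w} (d : ℕ) : ∃ C : ℝ, 0 < C ∧
    ∀ (N : ℕ) (Θ : Type w) [MeasurableSpace Θ] (Q : Measure Θ) [IsProbabilityMeasure Q]
      (T : Finset (Fin N)) (_ : T.Nonempty) (g : Fin N → Θ → Vec d) (_ : ∀ j, Measurable (g j))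
      (M : ℝ) (_ : 0 < M) (_ : ∀ j ∈ T, ∀ᵐ θ ∂Q, ‖g j θ‖ ^ 2 < M) (d₁ : ℕ)
      (_ : ∀ j ∈ T, ∀ᵐ θ ∂Q, g j θ ∈ lattice d₁) (μ : Measure (Vec d))
      (_ : ∀ᵐ y ∂μ, y ∈ lattice d₁) (B : ℝ)
      (_ : ∀ j ∈ T, W2 μ (Q.map (g j)) ≤ ENNReal.ofReal B),
      ∃ H : (Fin N → Θ) → ℝ≥0∞, Measurable H ∧
        (∀ᵐ θ ∂(Measure.pi fun _ : Fin N => Q),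
          genW2 d₁ μ (empirical T fun j => g j (θ j)) ≤ H θ) ∧
        ∫⁻ θ, H θ ∂(Measure.pi fun _ : Fin N => Q)
          ≤ ENNReal.ofReal B + ENNReal.ofReal (C * √M * isotropicRate d T.card) := by
  obtain ⟨C, hC, h⟩ := exists_W2_empirical_bound.{w} d
  refine ⟨C, hC, fun N Θ _ Q _ T hT g hg M hM hgM d₁ hgl μ hμ B hB => ?_⟩
  obtain ⟨H, hH, hae, hint⟩ := h N Θ Q T hT g hg M hM hgM
  have hmix : W2 μ (mixture T fun j => Q.map (g j)) ≤ ENNReal.ofReal B :=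
    transportDist_mixture_le hT ENNReal.ofReal_ne_top hB
  have hlat : ∀ᵐ θ ∂(Measure.pi fun _ : Fin N => Q), ∀ j ∈ T, g j (θ j) ∈ lattice d₁ := by
    rw [ae_all_iff]
    intro j
    by_cases hj : j ∈ T
    · filter_upwards [(measurePreserving_eval (fun _ : Fin N => Q) j).quasiMeasurePreserving.ae
        (hgl j hj)] with θ hθ _ using hθ
    · exact Filter.Eventually.of_forall fun _ h => absurd h hj
  refine ⟨fun θ => ENNReal.ofReal B + H θ, measurable_const.add hH, ?_, ?_⟩
  · filter_upwards [hae, hlat] with θ h1 h2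
    -- The average law is the intermediate point: `B` is the bias from the differing laws, `H θ` the
    -- fluctuation of the sample.
    refine (genW2_le_W2 hμ (ae_mixture fun j hj => ?_)).trans
      ((W2_triangle _ (mixture T fun j => Q.map (g j)) _).trans (add_le_add hmix h1))
    exact (ae_dirac_iff (measurableSet_lattice d₁)).2 (h2 j hj)
  · rw [lintegral_add_left measurable_const, lintegral_const, measure_univ, mul_one]
    gcongr

end Mixtures

/-! ### Stability of squared distances -/

section Differences

/-- Factor `a² - b² = (a + b) (a - b)`. An infinite `w` is harmless because `K > 0`. -/
theorem ofReal_abs_sub_toReal_sq_le {a b w : ℝ≥0∞} {K : ℝ} (hK : 0 < K)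
    (ha : a ≤ ENNReal.ofReal K) (hb : b ≤ ENNReal.ofReal K) (hab : a ≤ b + w) (hba : b ≤ a + w) :
    ENNReal.ofReal |(a ^ 2).toReal - (b ^ 2).toReal| ≤ ENNReal.ofReal (2 * K) * w := by
  rcases eq_or_ne w ∞ with rfl | hw
  · rw [ENNReal.mul_top (by simpa using hK)]
    exact le_top
  have ha' : a ≠ ∞ := ne_top_of_le_ne_top ENNReal.ofReal_ne_top ha
  have hb' : b ≠ ∞ := ne_top_of_le_ne_top ENNReal.ofReal_ne_top hb
  lift a to NNReal using ha'
  lift b to NNReal using hb'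
  lift w to NNReal using hw
  rw [← ENNReal.ofReal_coe_nnreal (p := w), ← ENNReal.ofReal_mul (by positivity)]
  refine ENNReal.ofReal_le_ofReal ?_
  have h1 : (a : ℝ) ≤ K := by simpa using ENNReal.toReal_le_of_le_ofReal hK.le ha
  have h2 : (b : ℝ) ≤ K := by simpa using ENNReal.toReal_le_of_le_ofReal hK.le hb
  have h3 : (a : ℝ) ≤ b + w := by exact_mod_cast hab
  have h4 : (b : ℝ) ≤ a + w := by exact_mod_cast hba
  have h5 : |(a : ℝ) - b| ≤ w := abs_le.2 ⟨by linarith, by linarith⟩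
  have h0 : (0 : ℝ) ≤ a + b := by positivity
  simp only [ENNReal.toReal_pow, ENNReal.coe_toReal]
  rw [sq_sub_sq, abs_mul, abs_of_nonneg h0]
  gcongr
  linarith

variable {d : ℕ} {d₁ : ℕ} {M : ℝ}

/-- The properties that the output laws share: they are concentrated on a ball, and their
categorical components are integers. -/
structure IsAdmissible (d₁ : ℕ) (M : ℝ) (μ : Measure (Vec d)) : Prop where
  isProbabilityMeasure : IsProbabilityMeasure μ
  norm_sq_lt : ∀ᵐ y ∂μ, ‖y‖ ^ 2 < M
  mem_lattice : ∀ᵐ y ∂μ, y ∈ lattice d₁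

theorem IsAdmissible.genW2_le {μ μ' : Measure (Vec d)} (h : IsAdmissible d₁ M μ)
    (h' : IsAdmissible d₁ M μ') : genW2 d₁ μ μ' ≤ ENNReal.ofReal (2 * √M) := by
  have := h.1
  have := h'.1
  exact (genW2_le_W2 h.3 h'.3).trans (W2_le_of_norm_sq_lt h.2 h'.2)

theorem abs_sub_genW2_sq_le (hM : 0 < M) {μ μ' ρ ρ' : Measure (Vec d)} (hμ : IsAdmissible d₁ M μ)
    (hμ' : IsAdmissible d₁ M μ') (hρ : IsAdmissible d₁ M ρ) (hρ' : IsAdmissible d₁ M ρ') :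
    ENNReal.ofReal |(genW2 d₁ μ μ' ^ 2).toReal - (genW2 d₁ ρ ρ' ^ 2).toReal|
      ≤ ENNReal.ofReal (4 * √M) * (genW2 d₁ μ ρ + genW2 d₁ μ' ρ') := by
  have h := ofReal_abs_sub_toReal_sq_le (K := 2 * √M) (by positivity) (hμ.genW2_le hμ')
    (hρ.genW2_le hρ') (w := genW2 d₁ μ ρ + genW2 d₁ μ' ρ') ?_ ?_
  · rwa [show 2 * (2 * √M) = 4 * √M by ring] at h
  · calc genW2 d₁ μ μ' ≤ genW2 d₁ μ ρ + (genW2 d₁ ρ ρ' + genW2 d₁ ρ' μ') :=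
          (genW2_triangle _ _ ρ _).trans (by gcongr; exact genW2_triangle _ _ _ _)
      _ = _ := by rw [genW2_comm d₁ ρ' μ']; ring
  · calc genW2 d₁ ρ ρ' ≤ genW2 d₁ ρ μ + (genW2 d₁ μ μ' + genW2 d₁ μ' ρ') :=
          (genW2_triangle _ _ μ _).trans (by gcongr; exact genW2_triangle _ _ _ _)
      _ = _ := by rw [genW2_comm d₁ ρ μ]; ring

end Differences

/-! ### Fluctuation of the inputs -/

section Sampling

variable {N : ℕ} {α : Type*} [MeasurableSpace α]

theorem ae_pi_forall {ν : Measure α} [IsProbabilityMeasure ν] {p : α → Prop}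
    (h : ∀ᵐ x ∂ν, p x) : ∀ᵐ xs ∂(Measure.pi fun _ : Fin N => ν), ∀ j, p (xs j) :=
  ae_all_iff.2 fun j => (measurePreserving_eval (fun _ : Fin N => ν) j).quasiMeasurePreserving.ae h

/-- The variance of one term is at most `b ^ 2`; independence divides it by `N`, and the mean
absolute deviation is at most the standard deviation. -/
theorem lintegral_abs_integral_sub_average_le (hN : 0 < N) {ν : Measure α}
    [IsProbabilityMeasure ν] {γ : α → ℝ} (hγ : AEMeasurable γ ν) {b : ℝ} (hb0 : 0 ≤ b)
    (hb : ∀ᵐ x ∂ν, γ x ∈ Set.Icc 0 b) :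
    ∫⁻ xs, ENNReal.ofReal |∫ x, γ x ∂ν - (N : ℝ)⁻¹ * ∑ j, γ (xs j)|
        ∂(Measure.pi fun _ : Fin N => ν) ≤ ENNReal.ofReal (b / √N) := by
  have hN0 : (0 : ℝ) < N := by exact_mod_cast hN
  set P := Measure.pi fun _ : Fin N => ν with hP
  have hγ2 : MemLp γ 2 ν := memLp_of_bounded hb hγ.aestronglyMeasurable 2
  have hmp : ∀ j, MeasurePreserving (fun xs : Fin N → α => xs j) P ν := fun j =>
    measurePreserving_eval _ j
  set Y : Fin N → (Fin N → α) → ℝ := fun j xs => γ (xs j) with hY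
  have hY2 : ∀ j, MemLp (Y j) 2 P := fun j => hγ2.comp_measurePreserving (hmp j)
  have hind : iIndepFun Y P := iIndepFun_pi fun j => hγ
  have hEY : ∀ j, ∫ xs, Y j xs ∂P = ∫ x, γ x ∂ν := by
    intro j
    have h1 : ∫ xs, Y j xs ∂P = ∫ t, γ t ∂(P.map fun xs => xs j) :=
      (integral_map (hmp j).measurable.aemeasurable
        ((hmp j).map_eq ▸ hγ.aestronglyMeasurable)).symm
    rw [h1, (hmp j).map_eq]
  have hVar : ∀ j, Var[Y j; P] ≤ b ^ 2 := by
    intro j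
    refine (variance_le_expectation_sq (hY2 j).aestronglyMeasurable).trans ?_
    have hbd : ∀ᵐ xs ∂P, (Y j ^ 2) xs ≤ b ^ 2 := by
      filter_upwards [(hmp j).quasiMeasurePreserving.ae hb] with xs hxs
      exact pow_le_pow_left₀ hxs.1 hxs.2 2
    calc ∫ xs, (Y j ^ 2) xs ∂P ≤ ∫ _, b ^ 2 ∂P :=
          integral_mono_ae (hY2 j).integrable_sq (integrable_const _) hbd
      _ = b ^ 2 := by simp
  set S : (Fin N → α) → ℝ := fun xs => (N : ℝ)⁻¹ * (∑ j, Y j) xs with hS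
  have hS2 : MemLp S 2 P := (memLp_finsetSum' _ fun j _ => hY2 j).const_mul _
  have hES : ∫ xs, S xs ∂P = ∫ x, γ x ∂ν := by
    simp only [hS, Finset.sum_apply]
    rw [integral_const_mul, integral_finsetSum _ fun j _ => (hY2 j).integrable (by norm_num),
      Finset.sum_congr rfl fun j _ => hEY j]
    simp [hN0.ne']
  have hVS : Var[S; P] ≤ b ^ 2 / N := by
    rw [hS, variance_const_mul, IndepFun.variance_sum (fun j _ => hY2 j)
      fun i _ j _ hij => hind.indepFun hij]
    calc ((N : ℝ)⁻¹) ^ 2 * ∑ j, Var[Y j; P] ≤ ((N : ℝ)⁻¹) ^ 2 * (N * b ^ 2) := by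
          gcongr
          simpa using Finset.sum_le_card_nsmul Finset.univ _ _ fun j _ => hVar j
      _ = b ^ 2 / N := by field_simp
  have h := lintegral_abs_sub_integral_le hS2
  rw [hES] at h
  have hsd : √(Var[S; P]) ≤ b / √N := by
    rw [← Real.sqrt_sq hb0, ← Real.sqrt_div (by positivity)]
    exact Real.sqrt_le_sqrt hVS
  refine le_trans (le_of_eq (lintegral_congr fun xs => ?_))
    (h.trans (ENNReal.ofReal_le_ofReal hsd))
  simp only [hS, hY, Finset.sum_apply, abs_sub_comm]

end Sampling

/-! ### Fluctuation of the outputs for fixed inputs -/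

section Conditional

variable {d N : ℕ}

theorem inv_mul_sum_const (hN : 0 < N) (a : ℝ≥0∞) : (N : ℝ≥0∞)⁻¹ * ∑ _j : Fin N, a = a := by
  rw [Finset.sum_const, Finset.card_univ, Fintype.card_fin, nsmul_eq_mul, ← mul_assoc,
    ENNReal.inv_mul_cancel (by exact_mod_cast hN.ne') (by simp), one_mul]

theorem ofReal_abs_sub_average_le (hN : 0 < N) (A : ℝ) (U V : Fin N → ℝ) :
    ENNReal.ofReal |A - (N : ℝ)⁻¹ * ∑ j, V j|
      ≤ ENNReal.ofReal |A - (N : ℝ)⁻¹ * ∑ j, U j|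
        + (N : ℝ≥0∞)⁻¹ * ∑ j, ENNReal.ofReal |U j - V j| := by
  have hN0 : (0 : ℝ) < N := by exact_mod_cast hN
  rw [← ENNReal.ofReal_sum_of_nonneg fun _ _ => abs_nonneg _, ← ENNReal.ofReal_natCast,
    ← ENNReal.ofReal_inv_of_pos hN0, ← ENNReal.ofReal_mul (by positivity),
    ← ENNReal.ofReal_add (abs_nonneg _) (by positivity)]
  refine ENNReal.ofReal_le_ofReal ?_
  calc |A - (N : ℝ)⁻¹ * ∑ j, V j|
      = |(A - (N : ℝ)⁻¹ * ∑ j, U j) + (N : ℝ)⁻¹ * ∑ j, (U j - V j)| := by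
        rw [Finset.sum_sub_distrib]; ring_nf
    _ ≤ |A - (N : ℝ)⁻¹ * ∑ j, U j| + |(N : ℝ)⁻¹ * ∑ j, (U j - V j)| := abs_add_le _ _
    _ ≤ |A - (N : ℝ)⁻¹ * ∑ j, U j| + (N : ℝ)⁻¹ * ∑ j, |U j - V j| := by
        rw [abs_mul, abs_of_pos (inv_pos.2 hN0)]
        gcongr
        exact Finset.abs_sum_le_sum_abs _ _

theorem IsAdmissible.ae_comp {Θ : Type*} [MeasurableSpace Θ] {Q : Measure Θ} {g : Θ → Vec d}
    (hg : Measurable g) {d₁ : ℕ} {M : ℝ} (h : IsAdmissible d₁ M (Q.map g)) :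
    (∀ᵐ θ ∂Q, ‖g θ‖ ^ 2 < M) ∧ ∀ᵐ θ ∂Q, g θ ∈ lattice d₁ :=
  ⟨ae_of_ae_map hg.aemeasurable h.norm_sq_lt, ae_of_ae_map hg.aemeasurable h.mem_lattice⟩

theorem isAdmissible_map {Θ : Type*} [MeasurableSpace Θ] {Q : Measure Θ} [IsProbabilityMeasure Q]
    {g : Θ → Vec d} (hg : Measurable g) {d₁ : ℕ} {M : ℝ} (h : ∀ᵐ θ ∂Q, ‖g θ‖ ^ 2 < M)
    (h' : ∀ᵐ θ ∂Q, g θ ∈ lattice d₁) : IsAdmissible d₁ M (Q.map g) :=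
  ⟨Measure.isProbabilityMeasure_map hg.aemeasurable,
    (ae_map_iff hg.aemeasurable (measurableSet_lt (by fun_prop) measurable_const)).2 h,
    (ae_map_iff hg.aemeasurable (measurableSet_lattice d₁)).2 h'⟩

theorem isAdmissible_empirical {T : Finset (Fin N)} (hT : T.Nonempty) {z : Fin N → Vec d} {d₁ : ℕ}
    {M : ℝ} (h : ∀ j, ‖z j‖ ^ 2 < M) (h' : ∀ j, z j ∈ lattice d₁) :
    IsAdmissible d₁ M (empirical T z) :=
  ⟨isProbabilityMeasure_empirical hT z,
    ae_mixture fun j _ => (ae_dirac_iff (measurableSet_lt (by fun_prop) measurable_const)).2 (h j),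
    ae_mixture fun j _ => (ae_dirac_iff (measurableSet_lattice d₁)).2 (h' j)⟩

theorem ae_isAdmissible_empirical {Θ : Type*} [MeasurableSpace Θ] {Q : Measure Θ}
    [IsProbabilityMeasure Q] {T : Fin N → Finset (Fin N)} (hT : ∀ j, (T j).Nonempty)
    {g : Fin N → Θ → Vec d} (hg : ∀ j, Measurable (g j)) {d₁ : ℕ} {M : ℝ}
    (h : ∀ j, IsAdmissible d₁ M (Q.map (g j))) :
    ∀ᵐ θ ∂(Measure.pi fun _ : Fin N => Q),
      ∀ j, IsAdmissible d₁ M (empirical (T j) fun i => g i (θ i)) := by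
  have key : ∀ᵐ θ ∂(Measure.pi fun _ : Fin N => Q),
      ∀ i, ‖g i (θ i)‖ ^ 2 < M ∧ g i (θ i) ∈ lattice d₁ := by
    refine ae_all_iff.2 fun i =>
      (measurePreserving_eval (fun _ : Fin N => Q) i).quasiMeasurePreserving.ae
        (p := fun θ => ‖g i θ‖ ^ 2 < M ∧ g i θ ∈ lattice d₁) ?_
    exact ((h i).ae_comp (hg i)).1.and ((h i).ae_comp (hg i)).2
  filter_upwards [key] with θ hθ j
  exact isAdmissible_empirical (hT j) (fun i => (hθ i).1) fun i => (hθ i).2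

/-- The expected deviation of an average of squared generalized `W₂` distances of local empirical
measures, for fixed inputs. -/
theorem exists_conditional_bound.{w} (d : ℕ) : ∃ C : ℝ, 0 < C ∧
    ∀ (N : ℕ) (_ : 0 < N) (Θ : Type w) [MeasurableSpace Θ] (Q : Measure Θ)
      [IsProbabilityMeasure Q] (T : Fin N → Finset (Fin N)) (_ : ∀ j, (T j).Nonempty)
      (g g' : Fin N → Θ → Vec d) (_ : ∀ j, Measurable (g j)) (_ : ∀ j, Measurable (g' j))
      (M : ℝ) (_ : 0 < M) (d₁ : ℕ) (_ : ∀ j, IsAdmissible d₁ M (Q.map (g j)))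
      (_ : ∀ j, IsAdmissible d₁ M (Q.map (g' j))) (B : ℝ) (_ : 0 ≤ B)
      (_ : ∀ j, ∀ i ∈ T j, W2 (Q.map (g j)) (Q.map (g i)) ≤ ENNReal.ofReal B)
      (_ : ∀ j, ∀ i ∈ T j, W2 (Q.map (g' j)) (Q.map (g' i)) ≤ ENNReal.ofReal B) (A : ℝ),
      ∫⁻ θ, ENNReal.ofReal |A - (N : ℝ)⁻¹ * ∑ j, (genW2 d₁ (empirical (T j) fun i => g i (θ i))
          (empirical (T j) fun i => g' i (θ i)) ^ 2).toReal| ∂(Measure.pi fun _ : Fin N => Q)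
        ≤ ENNReal.ofReal |A - (N : ℝ)⁻¹ *
              ∑ j, (genW2 d₁ (Q.map (g j)) (Q.map (g' j)) ^ 2).toReal|
          + (ENNReal.ofReal (8 * C * M) *
              ((N : ℝ≥0∞)⁻¹ * ∑ j, ENNReal.ofReal (isotropicRate d (T j).card))
            + ENNReal.ofReal (8 * √M * B)) := by
  obtain ⟨C, hC, h⟩ := exists_genW2_empirical_bound.{w} d
  refine ⟨C, hC, fun N hN Θ _ Q _ T hT g g' hg hg' M hM d₁ ha ha' B hB hW hW' A => ?_⟩
  choose H hH hae hint using fun j => h N Θ Q (T j) (hT j) g hg M hM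
    (fun i _ => ((ha i).ae_comp (hg i)).1) d₁ (fun i _ => ((ha i).ae_comp (hg i)).2)
    (Q.map (g j)) (ha j).mem_lattice B (hW j)
  choose H' hH' hae' hint' using fun j => h N Θ Q (T j) (hT j) g' hg' M hM
    (fun i _ => ((ha' i).ae_comp (hg' i)).1) d₁ (fun i _ => ((ha' i).ae_comp (hg' i)).2)
    (Q.map (g' j)) (ha' j).mem_lattice B (hW' j)
  set A₀ := ENNReal.ofReal |A - (N : ℝ)⁻¹ *
    ∑ j, (genW2 d₁ (Q.map (g j)) (Q.map (g' j)) ^ 2).toReal|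
  have hNi : (N : ℝ≥0∞)⁻¹ ≠ ∞ := by simpa using hN.ne'
  have hm : ∀ j, Measurable fun θ => ENNReal.ofReal (4 * √M) * (H j θ + H' j θ) := fun j =>
    ((hH j).add (hH' j)).const_mul _
  calc _ ≤ ∫⁻ θ, (A₀ + (N : ℝ≥0∞)⁻¹ * ∑ j, ENNReal.ofReal (4 * √M) * (H j θ + H' j θ))
        ∂(Measure.pi fun _ : Fin N => Q) := by
        refine lintegral_mono_ae ?_
        filter_upwards [ae_all_iff.2 hae, ae_all_iff.2 hae', ae_isAdmissible_empirical hT hg ha,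
          ae_isAdmissible_empirical hT hg' ha'] with θ h1 h2 h3 h4
        refine (ofReal_abs_sub_average_le hN A
          (fun j => (genW2 d₁ (Q.map (g j)) (Q.map (g' j)) ^ 2).toReal) _).trans ?_
        gcongr with j _
        refine (abs_sub_genW2_sq_le hM (ha j) (ha' j) (h3 j) (h4 j)).trans ?_
        gcongr
        · exact h1 j
        · exact h2 j
    _ = A₀ + (N : ℝ≥0∞)⁻¹ * ∑ j, ENNReal.ofReal (4 * √M) *
          (∫⁻ θ, H j θ ∂(Measure.pi fun _ : Fin N => Q)
            + ∫⁻ θ, H' j θ ∂(Measure.pi fun _ : Fin N => Q)) := by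
        rw [lintegral_add_left measurable_const, lintegral_const, measure_univ, mul_one,
          lintegral_const_mul' _ _ hNi, lintegral_finsetSum _ fun j _ => hm j]
        simp only [lintegral_const_mul' _ _ ENNReal.ofReal_ne_top, lintegral_add_left (hH _)]
    _ ≤ A₀ + (N : ℝ≥0∞)⁻¹ * ∑ j, (ENNReal.ofReal (8 * C * M) *
          ENNReal.ofReal (isotropicRate d (T j).card) + ENNReal.ofReal (8 * √M * B)) := by
        gcongr with j _
        have hr := isotropicRate_nonneg d (T j).card
        refine (mul_le_mul' le_rfl (add_le_add (hint j) (hint' j))).trans_eq ?_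
        rw [← ENNReal.ofReal_add hB (by positivity), ← ENNReal.ofReal_add (by positivity)
          (by positivity), ← ENNReal.ofReal_mul (by positivity), ← ENNReal.ofReal_mul
          (by positivity), ← ENNReal.ofReal_add (by positivity) (by positivity)]
        congr 1
        -- The two fields give `4 √M · 2 (B + C √M · rate)`, and `√M · √M = M`.
        linear_combination 8 * C * isotropicRate d (T j).card * Real.mul_self_sqrt hM.le
    _ = _ := by
        rw [Finset.sum_add_distrib, mul_add, inv_mul_sum_const hN, ← Finset.mul_sum]
        ring

end Conditional

/-! ### The local loss and regularity of the field distance -/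

section Fields

variable {n d N : ℕ}

theorem lintegral_empirical_univ {α : Type*} [MeasurableSpace α] [MeasurableSingletonClass α]
    (z : Fin N → α) (F : α → ℝ≥0∞) :
    ∫⁻ x, F x ∂(empirical Finset.univ z) = (N : ℝ≥0∞)⁻¹ * ∑ j, F (z j) := by
  rw [empirical_eq_mixture, lintegral_mixture]
  simp

theorem genLocalLoss_toReal (d₁ : ℕ) (δ : ℝ) (xs : Fin N → Vec n) (ys ys' : Fin N → Vec d)
    (h : ∀ j, genW2 d₁ (empirical (nearby xs δ (xs j)) ys)
      (empirical (nearby xs δ (xs j)) ys') ≠ ∞) :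
    (genLocalLoss d₁ δ xs ys ys').toReal = (N : ℝ)⁻¹ *
      ∑ j, (genW2 d₁ (empirical (nearby xs δ (xs j)) ys)
        (empirical (nearby xs δ (xs j)) ys') ^ 2).toReal := by
  rw [genLocalLoss, lintegral_empirical_univ, ENNReal.toReal_mul, ENNReal.toReal_inv,
    ENNReal.toReal_natCast, ENNReal.toReal_sum fun j _ => ENNReal.pow_ne_top (h j)]

theorem mem_nearby {xs : Fin N → Vec n} {δ : ℝ} {x : Vec n} {j : Fin N} :
    j ∈ nearby xs δ x ↔ ‖xs j - x‖ ≤ δ := by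
  simp [nearby]

/-- A sample input is its own neighbour, so the local empirical measures at sample points are
probability measures and the rates have `k ≥ 1`. -/
theorem nearby_self_nonempty (xs : Fin N → Vec n) {δ : ℝ} (hδ : 0 ≤ δ) (j : Fin N) :
    (nearby xs δ (xs j)).Nonempty :=
  ⟨j, mem_nearby.2 (by simpa using hδ)⟩

/-- The squared distance is Lipschitz on `D` and extends continuously to the whole space. This
supplies almost everywhere measurability although `D` itself need not be measurable. -/
theorem exists_lipschitz_eqOn_genW2_sq {d₁ : ℕ} {M L : ℝ} (hM : 0 < M) (hL : 0 ≤ L)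
    {D : Set (Vec n)} {μ μ' : Vec n → Measure (Vec d)} (ha : ∀ x ∈ D, IsAdmissible d₁ M (μ x))
    (ha' : ∀ x ∈ D, IsAdmissible d₁ M (μ' x))
    (hW : ∀ x ∈ D, ∀ z ∈ D, W2 (μ x) (μ z) ≤ ENNReal.ofReal (L * ‖x - z‖))
    (hW' : ∀ x ∈ D, ∀ z ∈ D, W2 (μ' x) (μ' z) ≤ ENNReal.ofReal (L * ‖x - z‖)) :
    ∃ γ : Vec n → ℝ, Continuous γ ∧
      Set.EqOn (fun x => (genW2 d₁ (μ x) (μ' x) ^ 2).toReal) γ D := by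
  have hlip : LipschitzOnWith (Real.toNNReal (8 * √M * L))
      (fun x => (genW2 d₁ (μ x) (μ' x) ^ 2).toReal) D := by
    refine LipschitzOnWith.of_dist_le_mul fun x hx z hz => ?_
    rw [Real.coe_toNNReal _ (by positivity), Real.dist_eq, dist_eq_norm]
    refine (ENNReal.ofReal_le_ofReal_iff (by positivity)).1
      ((abs_sub_genW2_sq_le hM (ha x hx) (ha' x hx) (ha z hz) (ha' z hz)).trans ?_)
    refine (mul_le_mul' le_rfl (add_le_add
      ((genW2_le_W2 (ha x hx).3 (ha z hz).3).trans (hW x hx z hz))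
      ((genW2_le_W2 (ha' x hx).3 (ha' z hz).3).trans (hW' x hx z hz)))).trans_eq ?_
    rw [← ENNReal.ofReal_add (by positivity) (by positivity), ← ENNReal.ofReal_mul (by positivity)]
    congr 1
    ring
  obtain ⟨γ, hγ, heq⟩ := hlip.extend_real
  exact ⟨γ, hγ.continuous, heq⟩

end Fields

/-! ### The two main error terms -/

section Main

variable {n d N : ℕ}

theorem lintegral_abs_genW2SqField_sub_average_le {Ω Ω' : Type*} [MeasurableSpace Ω]
    [MeasurableSpace Ω'] (hN : 0 < N) {d₁ : ℕ} {M L : ℝ} (hM : 0 < M) (hL : 0 ≤ L)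
    {D : Set (Vec n)} {ν : Measure (Vec n)} [IsProbabilityMeasure ν] (hD : ∀ᵐ x ∂ν, x ∈ D)
    {P : Measure Ω} {P' : Measure Ω'} {f : Vec n → Ω → Vec d} {f' : Vec n → Ω' → Vec d}
    (ha : ∀ x ∈ D, IsAdmissible d₁ M (lawAt P f x))
    (ha' : ∀ x ∈ D, IsAdmissible d₁ M (lawAt P' f' x))
    (hW : ∀ x ∈ D, ∀ z ∈ D, W2 (lawAt P f x) (lawAt P f z) ≤ ENNReal.ofReal (L * ‖x - z‖))
    (hW' : ∀ x ∈ D, ∀ z ∈ D, W2 (lawAt P' f' x) (lawAt P' f' z)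
      ≤ ENNReal.ofReal (L * ‖x - z‖)) :
    AEMeasurable (fun x => (genW2 d₁ (lawAt P f x) (lawAt P' f' x) ^ 2).toReal) ν ∧
    ∫⁻ xs, ENNReal.ofReal |(genW2SqField d₁ ν P P' f f').toReal - (N : ℝ)⁻¹ *
        ∑ j, (genW2 d₁ (lawAt P f (xs j)) (lawAt P' f' (xs j)) ^ 2).toReal|
        ∂(Measure.pi fun _ : Fin N => ν) ≤ ENNReal.ofReal (4 * M / √N) := by
  obtain ⟨γ, hγ, heq⟩ := exists_lipschitz_eqOn_genW2_sq hM hL ha ha' hW hW'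
  have hm : AEMeasurable (fun x => (genW2 d₁ (lawAt P f x) (lawAt P' f' x) ^ 2).toReal) ν :=
    ⟨γ, hγ.measurable, hD.mono fun x hx => heq hx⟩
  have hle : ∀ x ∈ D, genW2 d₁ (lawAt P f x) (lawAt P' f' x) ^ 2 ≤ ENNReal.ofReal (4 * M) := by
    intro x hx
    have h := pow_le_pow_left₀ zero_le ((ha x hx).genW2_le (ha' x hx)) 2
    rwa [← ENNReal.ofReal_pow (by positivity), mul_pow, Real.sq_sqrt hM.le,
      show (2 : ℝ) ^ 2 * M = 4 * M by ring] at h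
  have hfin : ∀ᵐ x ∂ν, genW2 d₁ (lawAt P f x) (lawAt P' f' x) ^ 2 < ∞ :=
    hD.mono fun x hx => (hle x hx).trans_lt ENNReal.ofReal_lt_top
  have hmE : AEMeasurable (fun x => genW2 d₁ (lawAt P f x) (lawAt P' f' x) ^ 2) ν :=
    hm.ennreal_ofReal.congr (hfin.mono fun x hx => ENNReal.ofReal_toReal hx.ne)
  refine ⟨hm, ?_⟩
  rw [genW2SqField, ← integral_toReal hmE hfin]
  refine lintegral_abs_integral_sub_average_le hN hm (by positivity) ?_
  filter_upwards [hD] with x hx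
  exact ⟨ENNReal.toReal_nonneg, ENNReal.toReal_le_of_le_ofReal (by positivity) (hle x hx)⟩

/-- The latent variables are integrated out, and the scales enter here only through their order and
positivity. -/
theorem lintegral_average_isotropicRate_le {Θ : Type*} [MeasurableSpace Θ] {ν : Measure (Vec n)}
    [IsProbabilityMeasure ν] {R : Measure Θ} [IsProbabilityMeasure R] {δ : ℝ} (hδ : 0 ≤ δ)
    {σ : Vec n → Fin d → ℝ} (hσ : 4 < d → ∀ᵐ x ∂ν, Antitone (σ x) ∧ ∀ i, 0 < σ x i) :
    ∫⁻ xs, (N : ℝ≥0∞)⁻¹ * ∑ j, ENNReal.ofReal (isotropicRate d (nearby xs δ (xs j)).card)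
        ∂(Measure.pi fun _ : Fin N => ν)
      ≤ ∫⁻ s : Fin N → Vec n × Θ, ∫⁻ x, ENNReal.ofReal
          (rate (σ x) (nearby (fun j => (s j).1) δ x).card)
          ∂(empirical Finset.univ fun j => (s j).1) ∂(Measure.pi fun _ => ν.prod R) := by
  have hmap : (Measure.pi fun _ : Fin N => ν.prod R).map (fun s j => (s j).1)
      = Measure.pi fun _ : Fin N => ν := by
    have h := measurePreserving_arrowProdEquivProdArrow (Vec n) Θ (Fin N) (fun _ => ν) (fun _ => R)
    exact (measurePreserving_fst.comp h).map_eq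
  rw [← hmap]
  refine (lintegral_map_le _ _).trans (lintegral_mono_ae ?_)
  have hσ' : ∀ᵐ x ∂ν, 4 < d → Antitone (σ x) ∧ ∀ i, 0 < σ x i := by
    by_cases hd : 4 < d
    · exact (hσ hd).mono fun x hx _ => hx
    · exact Filter.Eventually.of_forall fun x h => absurd h hd
  have hσ₁ : ∀ᵐ z ∂(ν.prod R), 4 < d → Antitone (σ z.1) ∧ ∀ i, 0 < σ z.1 i :=
    Measure.quasiMeasurePreserving_fst.ae hσ'
  filter_upwards [ae_pi_forall (N := N) hσ₁] with s hs
  rw [lintegral_empirical_univ]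
  gcongr with j _
  exact isotropicRate_le_rate (nearby_self_nonempty _ hδ j).card_pos (hs j)

end Main

end RandomField

end

/-! ### Assembly -/

theorem corollary2p4 (d : ℕ) :
    ∃ C : ℝ, 0 < C ∧
      ∀ (d₁ n N : ℕ) (_ : d₁ ≤ d) (_ : 0 < N)
        -- the domain and the law of the inputs
        (D : Set (RandomField.Vec n)) (_ : Bornology.IsBounded D)
        (ν : Measure (RandomField.Vec n)) [IsProbabilityMeasure ν] (_ : ∀ᵐ x ∂ν, x ∈ D)
        -- the latent variables and the two random fields
        (Ω : Type u) (Ω' : Type v) [MeasurableSpace Ω] [MeasurableSpace Ω']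
        (P : Measure Ω) (P' : Measure Ω') [IsProbabilityMeasure P] [IsProbabilityMeasure P']
        (f : RandomField.Vec n → Ω → RandomField.Vec d)
        (f' : RandomField.Vec n → Ω' → RandomField.Vec d)
        (_ : Measurable (fun p : RandomField.Vec n × Ω => f p.1 p.2))
        (_ : Measurable (fun p : RandomField.Vec n × Ω' => f' p.1 p.2))
        (M₀ L δ : ℝ) (_ : 0 ≤ L) (_ : 0 < δ)
        -- uniform boundedness
        (_ : ∀ x ∈ D, ∀ᵐ ω ∂P, ‖f x ω‖ ^ 2 < M₀)
        (_ : ∀ x ∈ D, ∀ᵐ ω ∂P', ‖f' x ω‖ ^ 2 < M₀)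
        -- Lipschitz continuity in the `W₂` distance
        (_ : ∀ x ∈ D, ∀ z ∈ D, RandomField.W2 (RandomField.lawAt P f x) (RandomField.lawAt P f z)
          ≤ ENNReal.ofReal (L * ‖x - z‖))
        (_ : ∀ x ∈ D, ∀ z ∈ D, RandomField.W2 (RandomField.lawAt P' f' x)
          (RandomField.lawAt P' f' z) ≤ ENNReal.ofReal (L * ‖x - z‖))
        -- the components after the first `d₁` are categorical, with integer class labels
        (_ : ∀ x ∈ D, ∀ᵐ ω ∂P, ∀ i : Fin d, d₁ ≤ (i : ℕ) → ∃ k : ℤ, f x ω i = k)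
        (_ : ∀ x ∈ D, ∀ᵐ ω ∂P', ∀ i : Fin d, d₁ ≤ (i : ℕ) → ∃ k : ℤ, f' x ω i = k)
        -- the laws from which the scales `σ_1 ≥ … ≥ σ_d > 0` are computed
        (ρ : RandomField.Vec n → Measure (RandomField.Vec d))
        (_ : (ρ = RandomField.localLaw ν P f δ ∨ ρ = RandomField.lawAt P f ∨
              ρ = fun _ => RandomField.overallLaw ν P f) ∨
             (ρ = RandomField.localLaw ν P' f' δ ∨ ρ = RandomField.lawAt P' f' ∨
              ρ = fun _ => RandomField.overallLaw ν P' f'))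
        (_ : 4 < d → ∀ᵐ x ∂ν, Antitone (RandomField.sixthScale (ρ x)) ∧
          ∀ i, 0 < RandomField.sixthScale (ρ x) i),
        -- a sample point `s` consists of `N` independent triples `(x, ω, ω')`
        ∫⁻ s : Fin N → RandomField.Vec n × Ω × Ω',
            ENNReal.ofReal |(RandomField.genW2SqField d₁ ν P P' f f').toReal
              - (RandomField.genLocalLoss d₁ δ (fun j => (s j).1)
                  (fun j => f (s j).1 (s j).2.1) (fun j => f' (s j).1 (s j).2.2)).toReal|
            ∂(Measure.pi fun _ => ν.prod (P.prod P'))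
          ≤ ENNReal.ofReal (4 * M₀ / √(N : ℝ))
            + ENNReal.ofReal (8 * C * M₀) *
              ∫⁻ s : Fin N → RandomField.Vec n × Ω × Ω',
                ∫⁻ x, ENNReal.ofReal (RandomField.rate (RandomField.sixthScale (ρ x))
                    (RandomField.nearby (fun j => (s j).1) δ x).card)
                  ∂(RandomField.empirical Finset.univ fun j => (s j).1)
                ∂(Measure.pi fun _ => ν.prod (P.prod P'))
            + ENNReal.ofReal (8 * √M₀ * L * δ) := by
  -- The constant is fixed before the latent spaces; the universe is that of their product.
  obtain ⟨C, hC, hcond⟩ := RandomField.exists_conditional_bound.{max u v} d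
  refine ⟨C, hC, fun d₁ n N _ hN D _ ν _ hD Ω Ω' _ _ P P' _ _ f f' hf hf' M₀ L δ hL hδ hb hb' hW hW'
    hl hl' ρ _ hσ => ?_⟩
  -- Probability measures charge at least one admissible input and one latent value, where `0 ≤ ‖f x
  -- ω‖ ^ 2 < M₀`.
  have hM : 0 < M₀ := by
    obtain ⟨x, hx⟩ := hD.exists
    obtain ⟨ω, hω⟩ := (hb x hx).exists
    exact (sq_nonneg _).trans_lt hω
  have hfx : ∀ x, Measurable (f x) := fun x => hf.comp measurable_prodMk_left
  have hfx' : ∀ x, Measurable (f' x) := fun x => hf'.comp measurable_prodMk_left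
  have ha : ∀ x ∈ D, RandomField.IsAdmissible d₁ M₀ (RandomField.lawAt P f x) := fun x hx =>
    RandomField.isAdmissible_map (hfx x) (hb x hx) (hl x hx)
  have ha' : ∀ x ∈ D, RandomField.IsAdmissible d₁ M₀ (RandomField.lawAt P' f' x) := fun x hx =>
    RandomField.isAdmissible_map (hfx' x) (hb' x hx) (hl' x hx)
  have hlaw : ∀ x, (P.prod P').map (fun θ => f x θ.1) = RandomField.lawAt P f x := fun x => by
    have h := congrArg (Measure.map (f x)) (measurePreserving_fst (μ := P) (ν := P')).map_eq
    rwa [Measure.map_map (hfx x) measurable_fst] at h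
  have hlaw' : ∀ x, (P.prod P').map (fun θ => f' x θ.2) = RandomField.lawAt P' f' x := fun x => by
    have h := congrArg (Measure.map (f' x)) (measurePreserving_snd (μ := P) (ν := P')).map_eq
    rwa [Measure.map_map (hfx' x) measurable_snd] at h
  obtain ⟨hγ, hvar⟩ := RandomField.lintegral_abs_genW2SqField_sub_average_le hN hM hL hD ha ha'
    hW hW'
  set A := (RandomField.genW2SqField d₁ ν P P' f f').toReal
  set γ := fun x => (RandomField.genW2 d₁ (RandomField.lawAt P f x)
    (RandomField.lawAt P' f' x) ^ 2).toReal with hγdef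
  set R := P.prod P' with hR
  -- Separating all inputs from all latent variables turns conditioning on the inputs into an
  -- iterated integral.
  have hsplit := measurePreserving_arrowProdEquivProdArrow (RandomField.Vec n) (Ω × Ω') (Fin N)
    (fun _ => ν) (fun _ => R)
  set F : (Fin N → RandomField.Vec n) × (Fin N → Ω × Ω') → ENNReal := fun p =>
    ENNReal.ofReal |A - (RandomField.genLocalLoss d₁ δ p.1 (fun j => f (p.1 j) (p.2 j).1)
      (fun j => f' (p.1 j) (p.2 j).2)).toReal| with hF
  have hinner : ∀ᵐ xs ∂(Measure.pi fun _ : Fin N => ν),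
      ∫⁻ θ, F (xs, θ) ∂(Measure.pi fun _ : Fin N => R)
        ≤ ENNReal.ofReal |A - (N : ℝ)⁻¹ * ∑ j, γ (xs j)|
          + (ENNReal.ofReal (8 * C * M₀) * ((N : ENNReal)⁻¹ * ∑ j, ENNReal.ofReal
              (RandomField.isotropicRate d (RandomField.nearby xs δ (xs j)).card))
            + ENNReal.ofReal (8 * √M₀ * (L * δ))) := by
    filter_upwards [RandomField.ae_pi_forall hD] with xs hxs
    have hne := RandomField.nearby_self_nonempty xs hδ.le
    have hg : ∀ j, Measurable fun θ : Ω × Ω' => f (xs j) θ.1 := fun j =>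
      (hfx _).comp measurable_fst
    have hg' : ∀ j, Measurable fun θ : Ω × Ω' => f' (xs j) θ.2 := fun j =>
      (hfx' _).comp measurable_snd
    have hadm : ∀ j, RandomField.IsAdmissible d₁ M₀ (R.map fun θ => f (xs j) θ.1) := fun j =>
      (hlaw (xs j)).symm ▸ ha _ (hxs j)
    have hadm' : ∀ j, RandomField.IsAdmissible d₁ M₀ (R.map fun θ => f' (xs j) θ.2) := fun j =>
      (hlaw' (xs j)).symm ▸ ha' _ (hxs j)
    have hdist : ∀ j, ∀ i ∈ RandomField.nearby xs δ (xs j),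
        ENNReal.ofReal (L * ‖xs j - xs i‖) ≤ ENNReal.ofReal (L * δ) := fun j i hi => by
      have := RandomField.mem_nearby.1 hi
      rw [norm_sub_rev] at this
      gcongr
    have h := hcond N hN (Ω × Ω') R (fun j => RandomField.nearby xs δ (xs j)) hne
      (fun j θ => f (xs j) θ.1) (fun j θ => f' (xs j) θ.2) hg hg' M₀ hM d₁ hadm hadm' (L * δ)
      (by positivity)
      (fun j i hi => by
        rw [hlaw, hlaw]
        exact (hW _ (hxs j) _ (hxs i)).trans (hdist j i hi))
      (fun j i hi => by
        rw [hlaw', hlaw']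
        exact (hW' _ (hxs j) _ (hxs i)).trans (hdist j i hi)) A
    simp only [hlaw, hlaw'] at h
    refine le_trans (lintegral_mono_ae ?_) h
    filter_upwards [RandomField.ae_isAdmissible_empirical hne hg hadm,
      RandomField.ae_isAdmissible_empirical hne hg' hadm'] with θ h1 h2
    refine le_of_eq ?_
    simp only [hF]
    rw [RandomField.genLocalLoss_toReal]
    exact fun j => ne_top_of_le_ne_top ENNReal.ofReal_ne_top ((h1 j).genW2_le (h2 j))
  -- Additivity of the lower integral requires one measurable summand; the input fluctuation is the
  -- one available.
  have hmeas : AEMeasurable (fun xs : Fin N → RandomField.Vec n =>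
      ENNReal.ofReal |A - (N : ℝ)⁻¹ * ∑ j, γ (xs j)|) (Measure.pi fun _ : Fin N => ν) := by
    have hj : ∀ j, AEMeasurable (fun xs : Fin N → RandomField.Vec n => γ (xs j))
        (Measure.pi fun _ : Fin N => ν) := fun j =>
      hγ.comp_quasiMeasurePreserving
        (measurePreserving_eval (fun _ : Fin N => ν) j).quasiMeasurePreserving
    have hs := Finset.aemeasurable_fun_sum Finset.univ fun j _ => hj j
    exact (((hs.const_mul _).const_sub A).norm).ennreal_ofReal
  have hrate := RandomField.lintegral_average_isotropicRate_le (N := N) (R := R) hδ.le hσ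
  calc _ = ∫⁻ s, F (MeasurableEquiv.arrowProdEquivProdArrow _ _ _ s)
          ∂(Measure.pi fun _ : Fin N => ν.prod R) := rfl
    _ = ∫⁻ p, F p ∂((Measure.pi fun _ : Fin N => ν).prod (Measure.pi fun _ : Fin N => R)) :=
        hsplit.lintegral_comp_emb (MeasurableEquiv.measurableEmbedding _) F
    -- This half of Tonelli's theorem holds without measurability of `F`.
    _ ≤ ∫⁻ xs, ∫⁻ θ, F (xs, θ) ∂(Measure.pi fun _ : Fin N => R)
          ∂(Measure.pi fun _ : Fin N => ν) := lintegral_prod_le F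
    _ ≤ _ := lintegral_mono_ae hinner
    _ ≤ _ := by
        rw [lintegral_add_left' hmeas, lintegral_add_right _ measurable_const, lintegral_const,
          measure_univ, mul_one, lintegral_const_mul' _ _ ENNReal.ofReal_ne_top, ← add_assoc,
          show 8 * √M₀ * (L * δ) = 8 * √M₀ * L * δ by ring]
        exact add_le_add (add_le_add hvar (mul_le_mul' le_rfl hrate)) le_rfl
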